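/- Let $k$ be a field and let $Q$ be a finite quiver with set of vertices $Q_0$, set of arrows $Q_1$ and source and target maps $s,t:Q_1\to Q_0$. Let $kQ$ be the quiver algebra, with $k$-basis the oriented paths of $Q$ (including the paths $x\in Q_0$ of length $0$, which are orthogonal idempotents with sum $1$); the product $pq$ of two paths is their concatenation ("first $q$, then $p$") if $s(p)=t(q)$, and $0$ otherwise. For a $k$-algebra $A$ let $A^e=A\otimes_k A^{op}$, identify $A$-bimodules with left $A^e$-modules, and put $HH^n(A,X)=\mathrm{Ext}^n_{A^e}(A,X)$ and $X^A=\{m\in X\mid am=ma \text{ for all } a\in A\}$ for an $A$-bimodule $X$. (1) For every $kQ$-bimodule $X$ we have, as an equality of cardinals, $$\dim_k HH^1(kQ,X)+\sum_{x\in Q_0}\dim_k xXx=\dim_k X^{kQ}+\sum_{a\in Q_1}\dim_k t(a)Xs(a).$$ In particular, if $X$ is finite dimensional, then $HH^1(kQ,X)$ is finite dimensional and $$\dim_k HH^1(kQ,X)=\dim_k X^{kQ}-\sum_{x\in Q_0}\dim_k xXx+\sum_{a\in Q_1}\dim_k t(a)Xs(a).$$ (2) Let $F=\langle Q_1\rangle$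 be the two-sided ideal of $kQ$ generated by the arrows, let $I$ be an admissible ideal, that is, a two-sided ideal with $F^n\subseteq I\subseteq F^2$ for some $n\ge 2$, and let $\Lambda=kQ/I$ be the corresponding bound quiver algebra. The $\Lambda$-bimodule $\Lambda$ has a minimal projective presentation $P_1\xrightarrow{d_1}P_0\to\Lambda\to 0$, that is, an exact sequence of $\Lambda^e$-modules in which $P_0\to\Lambda$ and $P_1\to\mathrm{Ker}(P_0\to\Lambda)$ are projective covers. For every such presentation let $\mathrm{Tr}\,\Lambda=\mathrm{Coker}\big(d_1^*:\mathrm{Hom}_{\Lambda^e}(P_0,\Lambda^e)\to\mathrm{Hom}_{\Lambda^e}(P_1,\Lambda^e)\big)$, let $\tau\Lambda=\mathrm{Hom}_k(\mathrm{Tr}\,\Lambda,k)$, and let the first $\tau$-Hochschild cohomology be $HH^1_\tau(\Lambda)=\mathrm{Hom}_k\big(\mathrm{Hom}_{\Lambda^e}(\Lambda,\tau\Lambda),k\big)$. Then $HH^1(kQ,kQ/I)$ and $HH^1_\tau(\Lambda)$ are finite dimensional and $$\dim_k HH^1(kQ,kQ/I)=\dim_k HH^1_\tau(\Lambda).$$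 -/

import Mathlib

open CategoryTheory TensorProduct MulOpposite
open scoped ModuleCat

universe u v w

/-! ### Quiver algebras and bound quiver algebras -/

/-- An oriented path of a quiver (possibly of length `0`), together with its source and target. -/
structure QuiverPath (V : Type v) [Quiver.{w} V] : Type (max v w) where
  source : V
  target : V
  path : Quiver.Path source target

namespace QuiverPath

variable {V : Type v} [Quiver.{w} V]

/-- The path of length `0` at a vertex. -/
def nil (x : V) : QuiverPath V := ⟨x, x, Quiver.Path.nil⟩

/-- The path of length `1` given by an arrow. -/
def ofArrow {x y : V} (a : x ⟶ y) : QuiverPath V := ⟨x, y, a.toPath⟩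

/-- The concatenation `p q` ("first `q`, then `p`"), which exists when `s(p) = t(q)`. -/
def concat (p q : QuiverPath V) (h : q.target = p.source) : QuiverPath V :=
  ⟨q.source, p.target, q.path.comp (p.path.cast h.symm rfl)⟩

end QuiverPath

/-- The quiver algebra `kQ`: the vector space with basis the set of all oriented paths. -/
def QuiverAlgebra (k : Type u) (V : Type v) [Field k] [Quiver.{w} V] : Type (max u v w) :=
  QuiverPath V →₀ k

namespace QuiverAlgebra

variable (k : Type u) (V : Type v) [Field k] [Quiver.{w} V]

noncomputable instance : AddCommGroup (QuiverAlgebra k V) :=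
  inferInstanceAs (AddCommGroup (QuiverPath V →₀ k))

noncomputable instance : Module k (QuiverAlgebra k V) :=
  inferInstanceAs (Module k (QuiverPath V →₀ k))

/-- The basis of `kQ` consisting of the paths. -/
noncomputable def pathBasis : Module.Basis (QuiverPath V) k (QuiverAlgebra k V) :=
  Finsupp.basisSingleOne

variable {V}

open Classical in
/-- The product of two paths: their concatenation if it is possible and `0` otherwise. -/
noncomputable def pathMul (p q : QuiverPath V) : QuiverAlgebra k V :=
  if h : q.target = p.source then pathBasis k V (p.concat q h) else 0

variable (V)

/-- The bilinear extension of the product of paths. -/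
noncomputable def mulBilin :
    QuiverAlgebra k V →ₗ[k] QuiverAlgebra k V →ₗ[k] QuiverAlgebra k V :=
  (pathBasis k V).constr k fun p => (pathBasis k V).constr k fun q => pathMul k p q

variable {V} in
lemma mulBilin_basis (p q : QuiverPath V) :
    mulBilin k V (pathBasis k V p) (pathBasis k V q) = pathMul k p q := by
  simp [mulBilin]

variable {V} in
lemma mulBilin_pathMul_left (p q r : QuiverPath V) :
    mulBilin k V (pathMul k p q) (pathBasis k V r) =
      mulBilin k V (pathBasis k V p) (pathMul k q r) := by
  obtain ⟨a, b, p⟩ := p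
  obtain ⟨c, d, q⟩ := q
  obtain ⟨e, f, r⟩ := r
  by_cases h₁ : d = a
  · subst h₁
    by_cases h₂ : f = c
    · subst h₂
      simp [pathMul, mulBilin_basis, QuiverPath.concat, Quiver.Path.comp_assoc]
    · simp [pathMul, mulBilin_basis, QuiverPath.concat, h₂]
  · by_cases h₂ : f = c
    · subst h₂
      simp [pathMul, mulBilin_basis, QuiverPath.concat, h₁]
    · simp [pathMul, h₁, h₂]

variable {k V} in
lemma ext_basis {M : Type*} [AddCommGroup M] [Module k M] {f g : QuiverAlgebra k V →ₗ[k] M}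
    (h : ∀ p, f (pathBasis k V p) = g (pathBasis k V p)) (x : QuiverAlgebra k V) : f x = g x :=
  LinearMap.congr_fun ((pathBasis k V).ext h) x

lemma mulBilin_assoc (x y z : QuiverAlgebra k V) :
    mulBilin k V (mulBilin k V x y) z = mulBilin k V x (mulBilin k V y z) := by
  refine ext_basis (f := (mulBilin k V).flip z ∘ₗ (mulBilin k V).flip y)
    (g := (mulBilin k V).flip (mulBilin k V y z)) (fun p => ?_) x
  refine ext_basis (f := (mulBilin k V).flip z ∘ₗ mulBilin k V (pathBasis k V p))
    (g := mulBilin k V (pathBasis k V p) ∘ₗ (mulBilin k V).flip z) (fun q => ?_) y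
  refine ext_basis (f := mulBilin k V (mulBilin k V (pathBasis k V p) (pathBasis k V q)))
    (g := mulBilin k V (pathBasis k V p) ∘ₗ mulBilin k V (pathBasis k V q)) (fun r => ?_) z
  simp only [LinearMap.comp_apply, mulBilin_basis, mulBilin_pathMul_left]

/-- The vertex `x`, viewed as an idempotent of `kQ`. -/
noncomputable def vertex {V : Type v} [Quiver.{w} V] (x : V) : QuiverAlgebra k V :=
  pathBasis k V (QuiverPath.nil x)

/-- The arrow `a`, viewed as an element of `kQ`. -/
noncomputable def arrow {V : Type v} [Quiver.{w} V] {x y : V} (a : x ⟶ y) : QuiverAlgebra k V :=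
  pathBasis k V (QuiverPath.ofArrow a)

lemma sum_vertex_mul [Fintype V] (z : QuiverAlgebra k V) :
    mulBilin k V (∑ x, vertex k x) z = z := by
  refine ext_basis (f := mulBilin k V (∑ x, vertex k x)) (g := LinearMap.id) (fun p => ?_) z
  obtain ⟨a, b, p⟩ := p
  rw [map_sum, LinearMap.sum_apply, Finset.sum_eq_single b]
  · simp [vertex, mulBilin_basis, pathMul, QuiverPath.nil, QuiverPath.concat]
  · intro x _ hx
    simp [vertex, mulBilin_basis, pathMul, QuiverPath.nil, hx.symm]
  · simp

lemma mul_sum_vertex [Fintype V] (z : QuiverAlgebra k V) :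
    mulBilin k V z (∑ x, vertex k x) = z := by
  refine ext_basis (f := (mulBilin k V).flip (∑ x, vertex k x)) (g := LinearMap.id)
    (fun p => ?_) z
  obtain ⟨a, b, p⟩ := p
  rw [map_sum, LinearMap.sum_apply, Finset.sum_eq_single a]
  · simp [vertex, mulBilin_basis, pathMul, QuiverPath.nil, QuiverPath.concat]
  · intro x _ hx
    simp [vertex, mulBilin_basis, pathMul, QuiverPath.nil, hx]
  · simp

/-- The ring structure of `kQ`; its unit is the sum of the vertices. -/
noncomputable instance [Fintype V] : Ring (QuiverAlgebra k V) :=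
  { (inferInstance : AddCommGroup (QuiverAlgebra k V)) with
    mul := fun x y => mulBilin k V x y
    one := ∑ x, vertex k x
    mul_assoc := mulBilin_assoc k V
    one_mul := sum_vertex_mul k V
    mul_one := mul_sum_vertex k V
    left_distrib := fun x y z => map_add (mulBilin k V x) y z
    right_distrib := fun x y z => LinearMap.map_add₂ (mulBilin k V) x y z
    zero_mul := fun x => LinearMap.map_zero₂ (mulBilin k V) x
    mul_zero := fun x => map_zero (mulBilin k V x) }

noncomputable instance [Fintype V] : Algebra k (QuiverAlgebra k V) :=
  Algebra.ofModule (fun r x y => LinearMap.map_smul₂ (mulBilin k V) r x y)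
    (fun r x y => map_smul (mulBilin k V x) r y)

/-- The two-sided ideal `F = ⟨Q₁⟩` of `kQ` generated by the arrows. -/
noncomputable def arrowIdeal [Fintype V] : Ideal (QuiverAlgebra k V) :=
  (TwoSidedIdeal.span {z | ∃ (x y : V) (a : x ⟶ y), z = arrow k a}).asIdeal

variable {k V} in
/-- A two-sided ideal `I` of `kQ` is admissible if `Fⁿ ⊆ I ⊆ F²` for some `n ≥ 2`. -/
def IsAdmissible [Fintype V] (I : Ideal (QuiverAlgebra k V)) : Prop :=
  ∃ n : ℕ, 2 ≤ n ∧ arrowIdeal k V ^ n ≤ I ∧ I ≤ arrowIdeal k V ^ 2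

end QuiverAlgebra

/-! ### Bimodules and Hochschild cohomology -/

section Bimodules

variable (k : Type u) [Field k]

/-- The enveloping algebra `A ⊗ Aᵒᵖ`. Its left modules are the `A`-bimodules (with `k` acting
centrally): `(a ⊗ b) m` is `a m b`. -/
abbrev Envelope (A : Type v) [Ring A] [Algebra k A] : Type v := A ⊗[k] Aᵐᵒᵖ

variable (A : Type v) [Ring A] [Algebra k A]

/-- The algebra `A` as a bimodule over itself. -/
noncomputable def regularBimodule : ModuleCat.{v} (Envelope k A) :=
  letI : Module (Envelope k A) A := TensorProduct.Algebra.module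
  ModuleCat.of (Envelope k A) A

variable {A} in
/-- A `B`-bimodule viewed as an `A`-bimodule through an algebra morphism `A → B`. -/
noncomputable def restrictBimodule {B : Type w} [Ring B] [Algebra k B] (φ : A →ₐ[k] B)
    (X : ModuleCat.{w} (Envelope k B)) : ModuleCat.{w} (Envelope k A) :=
  (ModuleCat.restrictScalars
    (Algebra.TensorProduct.map φ (AlgHom.op φ)).toRingHom).obj X

variable {A}

/-- The invariants `X^A = {m | a m = m a for all a ∈ A}` of an `A`-bimodule `X`. -/
noncomputable def bimoduleInvariants (X : ModuleCat.{w} (Envelope k A)) : Submodule k X :=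
  ⨅ a : A, LinearMap.ker (Algebra.lsmul k k X (a ⊗ₜ[k] (1 : Aᵐᵒᵖ) : Envelope k A) -
    Algebra.lsmul k k X (1 ⊗ₜ[k] op a : Envelope k A))

/-- The subspace `e X f = {e m f | m ∈ X}` of an `A`-bimodule `X`. -/
noncomputable def bimoduleCorner (X : ModuleCat.{w} (Envelope k A)) (e f : A) : Submodule k X :=
  LinearMap.range (Algebra.lsmul k k X (e ⊗ₜ[k] op f : Envelope k A))

end Bimodules

/-- The Hochschild cohomology `HHⁿ(A, X) = Extⁿ_{Aᵉ}(A, X)` of `A` with coefficients in the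
`A`-bimodule `X`. -/
noncomputable abbrev HochschildCohomology (k : Type u) [Field k] (A : Type v) [Ring A]
    [Algebra k A] (X : ModuleCat.{v} (Envelope k A)) (n : ℕ) : Type v :=
  Abelian.Ext (regularBimodule k A) X n

/-! ### The Auslander-Reiten translation -/

section Translation

variable (k : Type u) [Field k] (A : Type v) [Ring A] [Algebra k A]

/-- A submodule `N` of `M` is superfluous if `N + L = M` implies `L = M`. -/
def IsSuperfluous {R : Type u} {M : Type v} [Ring R] [AddCommGroup M] [Module R M]
    (N : Submodule R M) : Prop :=
  ∀ L : Submodule R M, N ⊔ L = ⊤ → L = ⊤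

/-- A minimal projective presentation `P₁ → P₀ → M → 0` of a left `A`-module: an exact sequence
such that `P₀ → M` and `P₁ → Ker (P₀ → M)` are projective covers. -/
structure MinimalProjectivePresentation {A : Type v} [Ring A] (M : ModuleCat.{w} A) where
  P₁ : ModuleCat.{w} A
  P₀ : ModuleCat.{w} A
  d₁ : P₁ →ₗ[A] P₀
  d₀ : P₀ →ₗ[A] M
  projective₁ : Module.Projective A P₁
  projective₀ : Module.Projective A P₀
  exact : Function.Exact d₁ d₀
  surjective : Function.Surjective d₀
  superfluous₁ : IsSuperfluous (LinearMap.ker d₁)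
  superfluous₀ : IsSuperfluous (LinearMap.ker d₀)

namespace MinimalProjectivePresentation

variable {A} {M : ModuleCat.{w} A} (P : MinimalProjectivePresentation M)

/-- The morphism `d₁^* : Hom_A(P₀, A) → Hom_A(P₁, A)` of right `A`-modules. -/
def dualMap : (P.P₀ →ₗ[A] A) →ₗ[Aᵐᵒᵖ] (P.P₁ →ₗ[A] A) where
  toFun f := f ∘ₗ P.d₁
  map_add' _ _ := rfl
  map_smul' _ _ := rfl

/-- The transpose `Tr M = Coker d₁^*`, a right `A`-module. -/
abbrev Transpose : Type (max v w) :=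
  (P.P₁ →ₗ[A] A) ⧸ LinearMap.range P.dualMap

/-- The Auslander-Reiten translate `τ M = D Tr M`, with `D = Hom_k(-, k)`. -/
def Translate : Type (max u v w) := Module.Dual k P.Transpose

noncomputable instance : AddCommGroup (P.Translate k) :=
  inferInstanceAs (AddCommGroup (Module.Dual k P.Transpose))

noncomputable instance : Module k (P.Translate k) :=
  inferInstanceAs (Module k (Module.Dual k P.Transpose))

/-- The left `A`-module structure of `τ M = D Tr M`: `(a φ)(t) = φ(t a)`. -/
noncomputable instance : Module A (P.Translate k) :=
  Module.compHom (R := Module.End k (Module.Dual k P.Transpose))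
    (Module.Dual k P.Transpose)
    { toFun := fun a => (Algebra.lsmul k k P.Transpose (op a)).dualMap
      map_one' := LinearMap.ext fun φ => LinearMap.ext fun t => by simp
      map_mul' := fun a b => LinearMap.ext fun φ => LinearMap.ext fun t => by
        simp
      map_zero' := LinearMap.ext fun φ => LinearMap.ext fun t => by simp
      map_add' := fun a b => LinearMap.ext fun φ => LinearMap.ext fun t => by
        simp }

lemma translate_smul_apply (a : A) (φ : P.Translate k) (t : P.Transpose) :
    (show Module.Dual k P.Transpose from a • φ) t =
      (show Module.Dual k P.Transpose from φ) (op a • t) :=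
  rfl

instance : SMulCommClass A k (P.Translate k) where
  smul_comm a c φ :=
    map_smul (Algebra.lsmul k k P.Transpose (op a)).dualMap c
      (show Module.Dual k P.Transpose from φ)

end MinimalProjectivePresentation

end Translation

/-- The first `τ`-Hochschild cohomology `HH¹_τ(A, X) = D Hom_{A-A}(X, τ A)`, computed with a
minimal projective presentation of the `A`-bimodule `A`. -/
abbrev TauHochschildCohomology (k : Type u) [Field k] {A : Type v} [Ring A] [Algebra k A]
    (P : MinimalProjectivePresentation (regularBimodule k A))
    (X : ModuleCat.{w} (Envelope k A)) : Type (max u v w) :=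
  Module.Dual k (X →ₗ[Envelope k A] P.Translate k)

/-!
For an algebra `A` with a surjection `kQ → A`, consider the bimodules `P₀ = ⨁ₓ A x ⊗ x A` and
`P₁ = ⨁ₐ A t(a) ⊗ s(a) A` and the morphism `P₁ → P₀` which maps `t(a) ⊗ s(a)` to
`a ⊗ s(a) - t(a) ⊗ a`. Since `A` is generated by the vertices and the arrows, a family of elements
`m x ∈ x X x` with `a (m s(a)) = (m t(a)) a` for all arrows `a` is the same as an element of `X^A`.
Hence `P₁ → P₀ → A → 0` is exact (`exact_differential_augmentation`), and the cokernel `C(X)` of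
`Hom(P₀, X) → Hom(P₁, X)` satisfies
`dim C(X) + ∑ₓ dim x X x = dim X^A + ∑ₐ dim t(a) X s(a)` (`rank_homCokernel_add`).

For `A = kQ` the morphism `P₁ → P₀` is injective: a derivation of `kQ` can take arbitrary values on
the arrows, and the one with values `t(a) ⊗ s(a)` in `P₁` gives a retraction
(`differential_injective`). So `C(X) = HH¹(kQ, X)`, which is the first part.

For `A = Λ = kQ / I` with `Fⁿ ⊆ I ⊆ F²` the presentation is minimal. The common kernel of the
characters of `Λᵉ` given by pairs of vertices is nilpotent because `Fⁿ ⊆ I`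
(`envelopeRadical_pow_eq_bot`). It contains the coefficients of the elements of `Ker (P₁ → P₀)`
because `I ⊆ F²`: the coefficient of an arrow is a derivation of `kQ` that descends to `Λ`
(`coord_mem_envelopeRadical`). Nakayama's lemma for a nilpotent ideal gives the minimality.

Minimal presentations are unique up to isomorphism, and for finitely generated projective modules
`Hom(X, τ M)` is the dual of the cokernel of `Hom(P₀, X) → Hom(P₁, X)`
(`bijective_dualHomCokernelToHom`). So `HH¹_τ(Λ)` is the double dual of `C(Λ)`. By the dimension
formula, `C(Λ)` has the same dimension for `Λ` as for `kQ`, since neither the invariants nor the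
spaces `y X x` of a `Λ`-bimodule `X` change when `X` is regarded as a `kQ`-bimodule.
-/

/-! ### Superfluous submodules and projective covers -/

section Superfluous

/-- Nakayama's lemma for a nilpotent ideal. -/
lemma isSuperfluous_of_le_smul_top {R : Type u} {M : Type v} [Ring R] [AddCommGroup M] [Module R M]
    (J : Ideal R) {m : ℕ} (hJ : J ^ m = ⊥) {N : Submodule R M}
    (hN : N ≤ J • (⊤ : Submodule R M)) : IsSuperfluous N := by
  intro L hL
  have h1 : L ⊔ J • (⊤ : Submodule R M) = ⊤ := by
    refine top_le_iff.mp (hL.symm.le.trans ?_)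
    exact sup_le (hN.trans le_sup_right) le_sup_left
  have key : ∀ n : ℕ, L ⊔ J ^ n • (⊤ : Submodule R M) = ⊤ := by
    intro n
    induction n with
    | zero => rw [Submodule.pow_zero, Ideal.one_eq_top, Submodule.top_smul, sup_top_eq]
    | succ n ih =>
      have h2 : J ^ n • (⊤ : Submodule R M) ≤ L ⊔ J ^ (n + 1) • (⊤ : Submodule R M) :=
        calc J ^ n • (⊤ : Submodule R M) = J ^ n • (L ⊔ J • ⊤) := by rw [h1]
          _ = J ^ n • L ⊔ J ^ (n + 1) • ⊤ := by
            rw [Submodule.smul_sup, ← Submodule.mul_smul, Submodule.pow_succ]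
          _ ≤ L ⊔ J ^ (n + 1) • ⊤ := sup_le_sup_right Submodule.smul_le_right _
      exact top_le_iff.mp (ih.symm.le.trans (sup_le le_sup_left h2))
  have := key m
  rwa [hJ, Submodule.bot_smul, sup_bot_eq] at this

variable {R : Type*} [Ring R]

/-- A comparison map between projective covers is bijective. -/
lemma bijective_of_projective_cover {P P' M : Type w} [AddCommGroup P] [AddCommGroup P']
    [AddCommGroup M] [Module R P] [Module R P'] [Module R M] [Module.Projective R P']
    (π : P →ₗ[R] M) (π' : P' →ₗ[R] M) (hπ : Function.Surjective π)
    (hs : IsSuperfluous (LinearMap.ker π)) (hs' : IsSuperfluous (LinearMap.ker π'))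
    (f : P →ₗ[R] P') (hf : π' ∘ₗ f = π) : Function.Bijective f := by
  have hf' : ∀ p, π' (f p) = π p := fun p => LinearMap.congr_fun hf p
  have hsurj : Function.Surjective f := by
    rw [← LinearMap.range_eq_top]
    refine hs' _ (eq_top_iff.mpr fun p' _ => ?_)
    obtain ⟨p, hp⟩ := hπ (π' p')
    refine Submodule.mem_sup.mpr ⟨p' - f p, ?_, f p, ⟨p, rfl⟩, sub_add_cancel _ _⟩
    rw [LinearMap.mem_ker, map_sub, hf', hp, sub_self]
  obtain ⟨s, hs''⟩ := Module.projective_lifting_property f LinearMap.id hsurj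
  have hfs : ∀ p', f (s p') = p' := fun p' => LinearMap.congr_fun hs'' p'
  have hrange : LinearMap.range s = ⊤ := by
    refine hs _ (eq_top_iff.mpr fun p _ => ?_)
    refine Submodule.mem_sup.mpr ⟨p - s (f p), ?_, s (f p), ⟨f p, rfl⟩, sub_add_cancel _ _⟩
    rw [LinearMap.mem_ker, ← hf', map_sub, hfs, sub_self, map_zero]
  refine ⟨fun p q hpq => ?_, hsurj⟩
  obtain ⟨p', rfl⟩ := LinearMap.range_eq_top.mp hrange p
  obtain ⟨q', rfl⟩ := LinearMap.range_eq_top.mp hrange q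
  rw [hfs, hfs] at hpq
  rw [hpq]

/-- The projective covers `π` and `π'` of the same module are isomorphic over it. -/
lemma exists_equiv_of_projective_covers {P P' M : Type w} [AddCommGroup P] [AddCommGroup P']
    [AddCommGroup M] [Module R P] [Module R P'] [Module R M] [Module.Projective R P]
    [Module.Projective R P']
    (π : P →ₗ[R] M) (π' : P' →ₗ[R] M) (hπ : Function.Surjective π) (hπ' : Function.Surjective π')
    (hs : IsSuperfluous (LinearMap.ker π)) (hs' : IsSuperfluous (LinearMap.ker π')) :
    ∃ e : P ≃ₗ[R] P', ∀ p, π' (e p) = π p := by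
  obtain ⟨f, hf⟩ := Module.projective_lifting_property π' π hπ'
  exact ⟨LinearEquiv.ofBijective f (bijective_of_projective_cover π π' hπ hs hs' f hf),
    fun p => LinearMap.congr_fun hf p⟩

end Superfluous

/-! ### Cokernels of restriction maps between spaces of morphisms -/

section HomCokernel

variable (k : Type u) [Field k] {R : Type v} [Ring R]

/-- The `k`-linear map `Hom_R(N, X) → Hom_R(M, X)` given by composition with `d : M → N`. -/
def homRestrict {M N : Type*} [AddCommGroup M] [AddCommGroup N] [Module R M]
    [Module R N] (d : M →ₗ[R] N) (X : Type*) [AddCommGroup X] [Module R X] [Module k X]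
    [SMulCommClass R k X] : (N →ₗ[R] X) →ₗ[k] (M →ₗ[R] X) where
  toFun f := f ∘ₗ d
  map_add' _ _ := rfl
  map_smul' _ _ := rfl

/-- The cokernel of `Hom_R(N, X) → Hom_R(M, X)`, for a morphism `M → N`. -/
abbrev HomCokernel {M N : Type*} [AddCommGroup M] [AddCommGroup N] [Module R M]
    [Module R N] (d : M →ₗ[R] N) (X : Type*) [AddCommGroup X] [Module R X] [Module k X]
    [SMulCommClass R k X] :=
  (M →ₗ[R] X) ⧸ LinearMap.range (homRestrict k d X)

/-- An isomorphism of morphisms `d ≅ d'` induces an isomorphism of the cokernels. -/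
lemma nonempty_homCokernel_equiv {M N M' N' : Type*} [AddCommGroup M] [AddCommGroup N]
    [AddCommGroup M'] [AddCommGroup N'] [Module R M] [Module R N] [Module R M'] [Module R N']
    (d : M →ₗ[R] N) (d' : M' →ₗ[R] N') (e : M ≃ₗ[R] M') (e' : N ≃ₗ[R] N')
    (h : ∀ m, d' (e m) = e' (d m))
    (X : Type*) [AddCommGroup X] [Module R X] [Module k X] [SMulCommClass R k X] :
    Nonempty (HomCokernel k d X ≃ₗ[k] HomCokernel k d' X) := by
  let E : (M →ₗ[R] X) ≃ₗ[k] (M' →ₗ[R] X) :=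
    LinearEquiv.ofLinearMap (homRestrict k e.symm.toLinearMap X) (homRestrict k e.toLinearMap X)
      (by ext f x; simp [homRestrict]) (by ext f x; simp [homRestrict])
  refine ⟨Submodule.Quotient.equiv _ _ E ?_⟩
  ext g
  constructor
  · rintro ⟨_, ⟨f, rfl⟩, rfl⟩
    refine ⟨f ∘ₗ e'.symm.toLinearMap, LinearMap.ext fun m => ?_⟩
    have := h (e.symm m)
    rw [e.apply_symm_apply] at this
    simp [homRestrict, E, this]
  · rintro ⟨f, rfl⟩
    refine ⟨_, ⟨f ∘ₗ e'.toLinearMap, rfl⟩, LinearMap.ext fun m => ?_⟩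
    have := h (e.symm m)
    rw [e.apply_symm_apply] at this
    simp [homRestrict, E, this]

/-- Two minimal projective presentations of the same module are isomorphic: first the projective
covers of the module are compared, then those of the kernel. -/
lemma MinimalProjectivePresentation.exists_equiv {M : ModuleCat.{w} R}
    (P P' : MinimalProjectivePresentation M) :
    ∃ (e₁ : P.P₁ ≃ₗ[R] P'.P₁) (e₀ : P.P₀ ≃ₗ[R] P'.P₀), ∀ p, P'.d₁ (e₁ p) = e₀ (P.d₁ p) := by
  have := P.projective₀
  have := P'.projective₀
  have := P.projective₁
  have := P'.projective₁
  obtain ⟨e₀, h₀⟩ := exists_equiv_of_projective_covers P.d₀ P'.d₀ P.surjective P'.surjective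
    P.superfluous₀ P'.superfluous₀
  let π : P.P₁ →ₗ[R] LinearMap.ker P'.d₀ := (e₀.toLinearMap ∘ₗ P.d₁).codRestrict _ fun p => by
    simp [h₀, P.exact.apply_apply_eq_zero]
  let π' : P'.P₁ →ₗ[R] LinearMap.ker P'.d₀ := P'.d₁.codRestrict _ fun p => by
    simp [P'.exact.apply_apply_eq_zero]
  have hker : LinearMap.ker π = LinearMap.ker P.d₁ := by
    ext p; simp [π]
  have hker' : LinearMap.ker π' = LinearMap.ker P'.d₁ := by
    ext p; simp [π']
  obtain ⟨e₁, h₁⟩ := exists_equiv_of_projective_covers π π'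
    (by
      rintro ⟨y, hy⟩
      obtain ⟨y, rfl⟩ := e₀.surjective y
      rw [LinearMap.mem_ker, h₀] at hy
      obtain ⟨p, rfl⟩ := (P.exact y).mp hy
      exact ⟨p, rfl⟩)
    (by
      rintro ⟨y, hy⟩
      obtain ⟨p, rfl⟩ := (P'.exact y).mp hy
      exact ⟨p, rfl⟩)
    (hker ▸ P.superfluous₁) (hker' ▸ P'.superfluous₁)
  exact ⟨e₁, e₀, fun p => congrArg Subtype.val (h₁ p)⟩

end HomCokernel

/-! ### The first extension group -/

section Ext

variable (k : Type u) [Field k] {R : Type v} [Ring R] [Algebra k R]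

/-- Dimension shifting: if `0 → K → P → M → 0` is exact with `P` projective, then `Ext¹(M, X)` is
the cokernel of `Hom(P, X) → Hom(K, X)`. -/
lemma nonempty_homCokernel_equiv_ext [Small.{w} R] (S : ShortComplex (ModuleCat.{w} R))
    (hS : S.ShortExact)
    [Projective S.X₂] (X : ModuleCat.{w} R) :
    Nonempty (HomCokernel k S.f.hom X ≃ₗ[k] Abelian.Ext S.X₃ X 1) := by
  let δ : (S.X₁ →ₗ[R] X) →ₗ[k] Abelian.Ext S.X₃ X 1 :=
    { toFun := fun f => hS.extClass.comp (Abelian.Ext.mk₀ (ModuleCat.ofHom f)) (add_zero 1)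
      map_add' := fun f g => by
        rw [ModuleCat.ofHom_add, Abelian.Ext.mk₀_add, Abelian.Ext.comp_add]
      map_smul' := fun c f => by
        rw [RingHom.id_apply, ← Abelian.Ext.comp_smul, ← Abelian.Ext.mk₀_smul]
        rfl }
  have hker : LinearMap.ker δ = LinearMap.range (homRestrict k S.f.hom X) := by
    ext f
    constructor
    · intro hf
      obtain ⟨x, hx⟩ := Abelian.Ext.contravariant_sequence_exact₁ hS X
        (Abelian.Ext.mk₀ (ModuleCat.ofHom f)) (add_zero 1) hf
      obtain ⟨g, rfl⟩ := (Abelian.Ext.mk₀_bijective S.X₂ X).2 x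
      rw [Abelian.Ext.mk₀_comp_mk₀] at hx
      have := (Abelian.Ext.mk₀_bijective S.X₁ X).1 hx
      exact ⟨g.hom, congrArg ModuleCat.Hom.hom this⟩
    · rintro ⟨g, rfl⟩
      have : ModuleCat.ofHom (homRestrict k S.f.hom X g) = S.f ≫ ModuleCat.ofHom g := rfl
      change hS.extClass.comp _ (add_zero 1) = 0
      rw [this, ← Abelian.Ext.mk₀_comp_mk₀]
      exact hS.extClass_comp_assoc (h := rfl) _
  have hsurj : Function.Surjective δ := by
    intro x
    obtain ⟨y, hy⟩ := Abelian.Ext.contravariant_sequence_exact₃ hS X x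
      (Abelian.Ext.eq_zero_of_projective _) (add_zero 1)
    obtain ⟨g, rfl⟩ := (Abelian.Ext.mk₀_bijective S.X₁ X).2 y
    exact ⟨g.hom, hy⟩
  exact ⟨(Submodule.quotEquivOfEq _ _ hker.symm).trans (δ.quotKerEquivOfSurjective hsurj)⟩

end Ext

/-! ### Morphisms into the Auslander-Reiten translate -/

section Translate

variable (k : Type u) [Field k] {R : Type v} [Ring R] [Algebra k R]

/-- The dual basis lemma. -/
lemma exists_dual_basis (P : Type w) [AddCommGroup P] [Module R P] [Module.Finite R P]
    [Module.Projective R P] :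
    ∃ (n : ℕ) (b : Fin n → P) (f : Fin n → P →ₗ[R] R), ∀ p, ∑ i, f i p • b i = p := by
  obtain ⟨n, f, g, -, -, h⟩ := Module.Finite.exists_comp_eq_id_of_projective R P
  refine ⟨n, fun i => f (Pi.single i 1), fun i => LinearMap.proj i ∘ₗ g, fun p => ?_⟩
  have h2 : ∑ i, (g p) i • (Pi.single i 1 : Fin n → R) = g p := by
    ext j
    simp [Pi.single_apply]
  calc ∑ i, (g p) i • f (Pi.single i 1) = f (∑ i, (g p) i • Pi.single i 1) := by
        simp [map_sum]
    _ = f (g p) := by rw [h2]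
    _ = p := LinearMap.congr_fun h p

variable {M : ModuleCat.{w} R} (P : MinimalProjectivePresentation M)
  (X : ModuleCat.{w} R)

/-- The linear map `Hom_R(N, R) → Hom_R(N, X)`, `f ↦ (p ↦ f p • x)`. -/
def rankOne {N : Type*} [AddCommGroup N] [Module R N] (x : X) :
    (N →ₗ[R] R) →ₗ[k] (N →ₗ[R] X) where
  toFun f := LinearMap.toSpanSingleton R X x ∘ₗ f
  map_add' _ _ := LinearMap.ext fun _ => add_smul _ _ _
  map_smul' c f := LinearMap.ext fun p => smul_assoc c (f p) x

/-- A morphism out of a module with a dual basis is a sum of morphisms of the form `p ↦ f p • x`. -/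
lemma sum_rankOne {N : Type*} [AddCommGroup N] [Module R N] {n : ℕ} {b : Fin n → N}
    {f : Fin n → N →ₗ[R] R} (hb : ∀ p, ∑ i, f i p • b i = p) (g : N →ₗ[R] X) :
    ∑ i, rankOne k X (g (b i)) (f i) = g := by
  ext p
  conv_rhs => rw [← hb p]
  simp [rankOne]

/-- The map `P₁^* → Hom(P₁, X) → Coker(Hom(P₀, X) → Hom(P₁, X))`, `f ↦ f(-) x`, factors through
`Tr M`. -/
def transposeToHomCokernel (x : X) : P.Transpose →ₗ[k] HomCokernel k P.d₁ X :=
  (Submodule.liftQ ((LinearMap.range P.dualMap).restrictScalars k)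
    ((LinearMap.range (homRestrict k P.d₁ X)).mkQ ∘ₗ rankOne k X x) (by
      rintro _ ⟨h, rfl⟩
      exact (Submodule.Quotient.mk_eq_zero _).mpr ⟨rankOne k X x h, rfl⟩)) ∘ₗ
    (Submodule.Quotient.restrictScalarsEquiv k (LinearMap.range P.dualMap)).symm.toLinearMap

lemma transposeToHomCokernel_mk (x : X) (f : P.P₁ →ₗ[R] R) :
    transposeToHomCokernel k P X x (Submodule.Quotient.mk f) =
      Submodule.Quotient.mk (rankOne k X x f) :=
  rfl

/-- A linear form `ψ` on the cokernel of `Hom(P₀, X) → Hom(P₁, X)` defines the morphism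
`X → τ M = D Tr M`, `x ↦ (f ↦ ψ (f(-) x))`. -/
def dualHomCokernelToHom :
    Module.Dual k (HomCokernel k P.d₁ X) →ₗ[k] (X →ₗ[R] P.Translate k) where
  toFun ψ :=
    { toFun := fun x => (ψ ∘ₗ transposeToHomCokernel k P X x : Module.Dual k P.Transpose)
      map_add' := fun x y => LinearMap.ext fun t => by
        induction t using Submodule.Quotient.induction_on with | _ f
        change ψ (transposeToHomCokernel k P X _ _) = ψ (transposeToHomCokernel k P X _ _) +
          ψ (transposeToHomCokernel k P X _ _)
        rw [transposeToHomCokernel_mk, transposeToHomCokernel_mk, transposeToHomCokernel_mk,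
          ← map_add, ← Submodule.Quotient.mk_add]
        congr 2
        ext p
        exact smul_add _ _ _
      map_smul' := fun r x => LinearMap.ext fun t => by
        induction t using Submodule.Quotient.induction_on with | _ f
        change ψ (transposeToHomCokernel k P X _ _) = ψ (transposeToHomCokernel k P X _ (op r • _))
        rw [← Submodule.Quotient.mk_smul, transposeToHomCokernel_mk, transposeToHomCokernel_mk]
        congr 2
        ext p
        exact (mul_smul (f p) r x).symm }
  map_add' _ _ := rfl
  map_smul' _ _ := rfl

lemma dualHomCokernelToHom_mk (ψ : Module.Dual k (HomCokernel k P.d₁ X)) (x : X)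
    (f : P.P₁ →ₗ[R] R) :
    (show Module.Dual k P.Transpose from dualHomCokernelToHom k P X ψ x)
      (Submodule.Quotient.mk f) = ψ (Submodule.Quotient.mk (rankOne k X x f)) :=
  rfl

/-- The defining formula of the translate, for a minimal presentation by finitely generated
projective modules: `Hom(X, τ M) ≅ D Coker(Hom(P₀, X) → Hom(P₁, X))`. -/
lemma bijective_dualHomCokernelToHom [Module.Finite R P.P₀] [Module.Finite R P.P₁] :
    Function.Bijective (dualHomCokernelToHom k P X) := by
  have := P.projective₀
  have := P.projective₁
  obtain ⟨n, b, f, hb⟩ := exists_dual_basis (R := R) P.P₁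
  obtain ⟨m, c, g, hc⟩ := exists_dual_basis (R := R) P.P₀
  constructor
  · refine (injective_iff_map_eq_zero _).mpr fun ψ hψ => LinearMap.ext fun t => ?_
    induction t using Submodule.Quotient.induction_on with | _ h
    have h0 : ∀ i, ψ (Submodule.Quotient.mk (rankOne k X (h (b i)) (f i))) = 0 := fun i => by
      rw [← dualHomCokernelToHom_mk, hψ]
      rfl
    rw [← sum_rankOne k X hb h, ← Submodule.mkQ_apply, map_sum, map_sum]
    exact Finset.sum_eq_zero fun i _ => h0 i
  · intro φ
    let ev : X → P.Transpose →ₗ[k] k := fun x => show Module.Dual k P.Transpose from φ x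
    have ev_add : ∀ x y, ev (x + y) = ev x + ev y := fun x y => map_add φ x y
    have ev_smul : ∀ (r : R) x t, ev (r • x) t = ev x (op r • t) := fun r x t => by
      change (show Module.Dual k P.Transpose from φ (r • x)) t = _
      rw [map_smul]
      rfl
    have ev_ksmul : ∀ (r : k) x, ev (r • x) = r • ev x := fun r x => by
      refine LinearMap.ext fun t => ?_
      rw [← algebraMap_smul R r x, ev_smul, LinearMap.smul_apply, ← map_smul]
      congr 1
      induction t using Submodule.Quotient.induction_on with | _ h
      rw [← Submodule.Quotient.mk_smul, ← Submodule.Quotient.mk_smul]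
      congr 1
      ext p
      exact (Algebra.commutes r (h p)).symm.trans (Algebra.smul_def r (h p)).symm
    -- The linear form that is determined by its values `φ x f` at the morphisms `p ↦ f p • x`.
    let ψ' : (P.P₁ →ₗ[R] X) →ₗ[k] k :=
      { toFun := fun h => ∑ i, ev (h (b i)) (Submodule.Quotient.mk (f i))
        map_add' := fun h h' => by simp [ev_add, Finset.sum_add_distrib]
        map_smul' := fun r h => by simp [ev_ksmul, Finset.mul_sum] }
    have hψ' : ∀ x h, ψ' (rankOne k X x h) = ev x (Submodule.Quotient.mk h) := fun x h => by
      have h1 : ∑ i, op (h (b i)) • f i = h := by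
        ext p
        conv_rhs => rw [← hb p]
        simp
      refine Eq.trans ?_ (congrArg (fun f => ev x (Submodule.Quotient.mk f)) h1)
      change ∑ i, ev (h (b i) • x) (Submodule.Quotient.mk (f i)) =
        ev x (Submodule.mkQ _ (∑ i, op (h (b i)) • f i))
      rw [map_sum, map_sum]
      exact Finset.sum_congr rfl fun i _ => ev_smul _ _ _
    have hle : LinearMap.range (homRestrict k P.d₁ X) ≤ LinearMap.ker ψ' := by
      rintro _ ⟨h, rfl⟩
      -- The dual basis of `P₀` reduces to morphisms of rank one, which already lift to `P₀^*`.
      rw [← sum_rankOne k X hc h, map_sum, LinearMap.mem_ker, map_sum]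
      refine Finset.sum_eq_zero fun j _ => (hψ' (h (c j)) (P.dualMap (g j))).trans ?_
      have h0 : (Submodule.Quotient.mk (P.dualMap (g j)) : P.Transpose) = 0 :=
        (Submodule.Quotient.mk_eq_zero _).mpr ⟨g j, rfl⟩
      rw [h0, map_zero]
    refine ⟨Submodule.liftQ _ ψ' hle, LinearMap.ext fun x => LinearMap.ext fun t => ?_⟩
    induction t using Submodule.Quotient.induction_on with | _ h
    exact hψ' x h

end Translate

/-! ### Projective modules defined by families of idempotents -/

section Idempotents

variable {R : Type*} [Ring R] {ι : Type*}

/-- The families `f` in `R` with `f i ∈ R eᵢ`, that is, `f i * e i = f i`. -/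
def idempotentSubmodule (e : ι → R) : Submodule R (ι → R) where
  carrier := {f | ∀ i, f i * e i = f i}
  add_mem' hf hg i := by simp [add_mul, hf i, hg i]
  zero_mem' i := zero_mul _
  smul_mem' r f hf i := by simp [mul_assoc, hf i]

/-- The left module `⨁ᵢ R eᵢ` of a family of idempotents, realized as a submodule of `ι → R`. -/
def IdempotentModule (e : ι → R) : Type _ := idempotentSubmodule e

namespace IdempotentModule

instance (e : ι → R) : AddCommGroup (IdempotentModule e) :=
  inferInstanceAs (AddCommGroup (idempotentSubmodule e))

instance (e : ι → R) : Module R (IdempotentModule e) :=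
  inferInstanceAs (Module R (idempotentSubmodule e))

variable {e : ι → R}

/-- The `i`-th component of an element of `⨁ᵢ R eᵢ`. -/
def coord (i : ι) : IdempotentModule e →ₗ[R] R :=
  LinearMap.proj i ∘ₗ (idempotentSubmodule e).subtype

lemma coord_mul (f : IdempotentModule e) (i : ι) : coord i f * e i = coord i f := f.2 i

lemma ext_coord {f g : IdempotentModule e} (h : ∀ i, coord i f = coord i g) : f = g :=
  Subtype.ext (funext h)

open Classical in
/-- The generator `eᵢ` of the summand `R eᵢ`. -/
noncomputable def gen (he : ∀ i, IsIdempotentElem (e i)) (i : ι) : IdempotentModule e :=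
  ⟨Pi.single i (e i), fun j => by
    rcases eq_or_ne j i with rfl | h
    · simpa using (he j).eq
    · simp [h]⟩

open Classical in
lemma coord_gen (he : ∀ i, IsIdempotentElem (e i)) (i : ι) : coord i (gen he i) = e i :=
  Pi.single_eq_same (M := fun _ => R) i (e i)

open Classical in
lemma coord_gen_of_ne (he : ∀ i, IsIdempotentElem (e i)) {i j : ι} (h : i ≠ j) :
    coord i (gen he j) = 0 :=
  Pi.single_eq_of_ne (M := fun _ => R) h (e j)

lemma idempotent_smul_gen (he : ∀ i, IsIdempotentElem (e i)) (i : ι) :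
    e i • gen he i = gen he i := by
  refine ext_coord fun j => ?_
  rw [map_smul]
  rcases eq_or_ne j i with rfl | h
  · rw [coord_gen, smul_eq_mul, (he j).eq]
  · rw [coord_gen_of_ne he h, smul_zero]

variable [Fintype ι]

lemma sum_smul_gen (he : ∀ i, IsIdempotentElem (e i)) (f : IdempotentModule e) :
    ∑ i, coord i f • gen he i = f := by
  refine ext_coord fun j => ?_
  rw [map_sum, Finset.sum_eq_single j]
  · rw [map_smul, coord_gen, smul_eq_mul, coord_mul]
  · intro i _ h
    rw [map_smul, coord_gen_of_ne he h.symm, smul_zero]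
  · simp

/-- The morphism `⨁ᵢ R eᵢ → X` given by elements `mᵢ` of `X`, which maps `eᵢ` to `eᵢ mᵢ`. -/
def lift (e : ι → R) {X : Type*} [AddCommGroup X] [Module R X] (m : ι → X) :
    IdempotentModule e →ₗ[R] X :=
  ∑ i, LinearMap.toSpanSingleton R X (m i) ∘ₗ coord i

lemma lift_apply {X : Type*} [AddCommGroup X] [Module R X] (m : ι → X) (f : IdempotentModule e) :
    lift e m f = ∑ i, coord i f • m i := by
  simp [lift]

lemma lift_gen (he : ∀ i, IsIdempotentElem (e i)) {X : Type*} [AddCommGroup X] [Module R X]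
    (m : ι → X) (i : ι) : lift e m (gen he i) = e i • m i := by
  rw [lift_apply, Finset.sum_eq_single i]
  · rw [coord_gen]
  · intro j _ h
    rw [coord_gen_of_ne he h, zero_smul]
  · simp

lemma hom_ext (he : ∀ i, IsIdempotentElem (e i)) {X : Type*} [AddCommGroup X] [Module R X]
    {f g : IdempotentModule e →ₗ[R] X} (h : ∀ i, f (gen he i) = g (gen he i)) : f = g := by
  refine LinearMap.ext fun p => ?_
  rw [← sum_smul_gen he p, map_sum, map_sum]
  exact Finset.sum_congr rfl fun i _ => by rw [map_smul, map_smul, h]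

lemma projective (he : ∀ i, IsIdempotentElem (e i)) : Module.Projective R (IdempotentModule e) := by
  refine Module.Projective.of_split (LinearMap.pi coord)
    (∑ i, LinearMap.toSpanSingleton R _ (gen he i) ∘ₗ LinearMap.proj i) ?_
  refine LinearMap.ext fun f => ?_
  simpa using sum_smul_gen he f

lemma finite (he : ∀ i, IsIdempotentElem (e i)) : Module.Finite R (IdempotentModule e) := by
  refine Module.Finite.of_surjective
    (∑ i, LinearMap.toSpanSingleton R _ (gen he i) ∘ₗ LinearMap.proj i : (ι → R) →ₗ[R] _)
    fun f => ⟨fun i => coord i f, ?_⟩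
  simpa using sum_smul_gen he f

/-- `Hom(⨁ᵢ R eᵢ, X) = ∏ᵢ eᵢ X`. -/
noncomputable def homEquiv (k : Type*) [Field k] [Algebra k R]
    (he : ∀ i, IsIdempotentElem (e i)) (X : Type*) [AddCommGroup X] [Module k X] [Module R X]
    [IsScalarTower k R X] :
    (IdempotentModule e →ₗ[R] X) ≃ₗ[k] ∀ i, LinearMap.range (Algebra.lsmul k k X (e i)) where
  toFun f i := ⟨f (gen he i), f (gen he i), by
    rw [Algebra.lsmul_apply, ← map_smul, idempotent_smul_gen]⟩
  map_add' _ _ := rfl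
  map_smul' _ _ := rfl
  invFun m := lift e fun i => (m i : X)
  left_inv f := hom_ext he fun i => by
    rw [lift_gen, ← map_smul, idempotent_smul_gen]
  right_inv m := by
    refine funext fun i => Subtype.ext ?_
    obtain ⟨x, hx⟩ := (m i).2
    change lift e (fun i => (m i : X)) (gen he i) = m i
    rw [lift_gen, ← hx, Algebra.lsmul_apply, ← mul_smul, he i]

end IdempotentModule

end Idempotents

/-! ### Generators and derivations of the quiver algebra -/

namespace QuiverAlgebra

variable (k : Type u) {V : Type v} [Field k] [Quiver.{w} V]

/-- A path, viewed as an element of `kQ`. -/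
noncomputable def ofPath {x y : V} (p : Quiver.Path x y) : QuiverAlgebra k V :=
  pathBasis k V ⟨x, y, p⟩

lemma ofPath_nil (x : V) : ofPath k (Quiver.Path.nil : Quiver.Path x x) = vertex k x := rfl

lemma ofPath_toPath {x y : V} (a : x ⟶ y) : ofPath k a.toPath = arrow k a := rfl

variable [Fintype V]

lemma mul_def (z w : QuiverAlgebra k V) : z * w = mulBilin k V z w := rfl

lemma one_def : (1 : QuiverAlgebra k V) = ∑ x, vertex k x := rfl

lemma ofPath_mul_ofPath {x y z : V} (q : Quiver.Path y z) (p : Quiver.Path x y) :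
    ofPath k q * ofPath k p = ofPath k (p.comp q) := by
  simp [mul_def, ofPath, mulBilin_basis, pathMul, QuiverPath.concat]

lemma ofPath_mul_ofPath_of_ne {x y y' z : V} (h : y ≠ y') (q : Quiver.Path y' z)
    (p : Quiver.Path x y) : ofPath k q * ofPath k p = 0 := by
  simp [mul_def, ofPath, mulBilin_basis, pathMul, h]

lemma ofPath_cons {x y z : V} (p : Quiver.Path x y) (a : y ⟶ z) :
    ofPath k (p.cons a) = arrow k a * ofPath k p := by
  rw [← ofPath_toPath, ofPath_mul_ofPath, Quiver.Path.comp_toPath_eq_cons]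

lemma vertex_mul_ofPath {x y : V} (p : Quiver.Path x y) : vertex k y * ofPath k p = ofPath k p := by
  rw [← ofPath_nil, ofPath_mul_ofPath, Quiver.Path.comp_nil]

lemma ofPath_mul_vertex {x y : V} (p : Quiver.Path x y) : ofPath k p * vertex k x = ofPath k p := by
  rw [← ofPath_nil, ofPath_mul_ofPath, Quiver.Path.nil_comp]

lemma vertex_mul_vertex (x : V) : vertex k x * vertex k x = vertex k x := vertex_mul_ofPath k _

lemma vertex_mul_vertex_of_ne {x y : V} (h : x ≠ y) : vertex k x * vertex k y = 0 :=
  ofPath_mul_ofPath_of_ne k h.symm _ _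

lemma vertex_mul_arrow {x y : V} (a : x ⟶ y) : vertex k y * arrow k a = arrow k a :=
  vertex_mul_ofPath k _

lemma arrow_mul_vertex {x y : V} (a : x ⟶ y) : arrow k a * vertex k x = arrow k a :=
  ofPath_mul_vertex k _

variable {k} in
/-- A property of elements of `kQ` that is linear only has to be checked on paths. -/
lemma path_induction {C : QuiverAlgebra k V → Prop} (z : QuiverAlgebra k V)
    (path : ∀ {x y : V} (p : Quiver.Path x y), C (ofPath k p)) (zero : C 0)
    (add : ∀ z w, C z → C w → C (z + w)) (smul : ∀ (c : k) z, C z → C (c • z)) : C z := by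
  have hz : z ∈ Submodule.span k (Set.range (pathBasis k V)) := by
    rw [(pathBasis k V).span_eq]; trivial
  induction hz using Submodule.span_induction with
  | mem _ h => obtain ⟨p, rfl⟩ := h; exact path p.path
  | zero => exact zero
  | add z w _ _ hz hw => exact add z w hz hw
  | smul c z _ hz => exact smul c z hz

variable {k} in
/-- The algebra `kQ` is generated by the vertices and the arrows. -/
lemma generator_induction {C : QuiverAlgebra k V → Prop} (z : QuiverAlgebra k V)
    (vertex : ∀ x : V, C (vertex k x)) (arrow : ∀ {x y : V} (a : x ⟶ y), C (arrow k a)) (zero : C 0)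
    (add : ∀ z w, C z → C w → C (z + w)) (smul : ∀ (c : k) z, C z → C (c • z))
    (mul : ∀ z w, C z → C w → C (z * w)) : C z := by
  refine path_induction z (fun {x y} p => ?_) zero add smul
  induction p with
  | nil => exact vertex _
  | cons p a ih => rw [ofPath_cons]; exact mul _ _ (arrow a) ih

section Derivation

variable {k} {X : Type*} [AddCommGroup X] [Module k X]
  (ρ : Envelope k (QuiverAlgebra k V) →ₐ[k] Module.End k X) (m : ∀ {x y : V}, (x ⟶ y) → X)

/-- The value on a path `aₙ ⋯ a₁` of the derivation with values `m aᵢ`, which is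
`∑ aₙ ⋯ aᵢ₊₁ (m aᵢ) aᵢ₋₁ ⋯ a₁`. -/
noncomputable def pathDerivation {x : V} : ∀ {y : V}, Quiver.Path x y → X
  | _, Quiver.Path.nil => 0
  | _, Quiver.Path.cons p a =>
    ρ (arrow k a ⊗ₜ 1) (pathDerivation p) + ρ (1 ⊗ₜ op (ofPath k p)) (m a)

lemma rho_rho (u v : Envelope k (QuiverAlgebra k V)) (x : X) : ρ u (ρ v x) = ρ (u * v) x := by
  rw [map_mul, Module.End.mul_apply]

lemma rho_vertex_pathDerivation
    (hm : ∀ {x y : V} (a : x ⟶ y), ρ (vertex k y ⊗ₜ op (vertex k x)) (m a) = m a)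
    {x y : V} (p : Quiver.Path x y) :
    ρ (vertex k y ⊗ₜ 1) (pathDerivation ρ m p) = pathDerivation ρ m p := by
  cases p with
  | nil => exact map_zero _
  | cons p a =>
    rw [pathDerivation, map_add, rho_rho, ← hm a, rho_rho, rho_rho]
    simp only [Algebra.TensorProduct.tmul_mul_tmul, one_mul, mul_one, vertex_mul_arrow,
      vertex_mul_vertex]
    rw [rho_rho, Algebra.TensorProduct.tmul_mul_tmul, one_mul]

lemma rho_op_vertex_pathDerivation {x y : V} (p : Quiver.Path x y) :
    ρ (1 ⊗ₜ op (vertex k x)) (pathDerivation ρ m p) = pathDerivation ρ m p := by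
  induction p with
  | nil => exact map_zero _
  | cons p a ih =>
    nth_rewrite 2 [pathDerivation]
    rw [← ih, pathDerivation, map_add, rho_rho, rho_rho, rho_rho]
    simp [← op_mul, ofPath_mul_vertex]

lemma pathDerivation_comp
    (hm : ∀ {x y : V} (a : x ⟶ y), ρ (vertex k y ⊗ₜ op (vertex k x)) (m a) = m a)
    {x y z : V} (p : Quiver.Path x y) (q : Quiver.Path y z) :
    pathDerivation ρ m (p.comp q) = ρ (ofPath k q ⊗ₜ 1) (pathDerivation ρ m p) +
      ρ (1 ⊗ₜ op (ofPath k p)) (pathDerivation ρ m q) := by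
  induction q with
  | nil =>
    rw [Quiver.Path.comp_nil, ofPath_nil, rho_vertex_pathDerivation ρ m hm, pathDerivation,
      map_zero,
      add_zero]
  | cons q a ih =>
    rw [Quiver.Path.comp_cons, pathDerivation, ih, pathDerivation, ofPath_cons, map_add, map_add,
      rho_rho, rho_rho, rho_rho, rho_rho, add_assoc, ← ofPath_mul_ofPath]
    simp

/-- A derivation of `kQ` with values in a bimodule that vanishes on the vertices is determined by
its values on the arrows, which are arbitrary elements of `t(a) X s(a)`. -/
lemma exists_derivation
    (hm : ∀ {x y : V} (a : x ⟶ y), ρ (vertex k y ⊗ₜ op (vertex k x)) (m a) = m a) :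
    ∃ δ : QuiverAlgebra k V →ₗ[k] X,
      (∀ z w, δ (z * w) = ρ (z ⊗ₜ 1) (δ w) + ρ (1 ⊗ₜ op w) (δ z)) ∧
      ∀ {x y : V} (a : x ⟶ y), δ (arrow k a) = m a := by
  let δ : QuiverAlgebra k V →ₗ[k] X := (pathBasis k V).constr k fun p => pathDerivation ρ m p.path
  have hδ : ∀ {x y : V} (p : Quiver.Path x y), δ (ofPath k p) = pathDerivation ρ m p := fun p => by
    simp [δ, ofPath]
  refine ⟨δ, fun z w => ?_, fun {x y} a => ?_⟩
  · induction z using path_induction with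
    | zero => simp
    | add z z' h h' =>
      rw [add_mul, map_add, h, h', TensorProduct.add_tmul, map_add, map_add, map_add]
      simp only [LinearMap.add_apply]
      abel
    | smul c z h =>
      rw [smul_mul_assoc, map_smul, h, ← TensorProduct.smul_tmul', map_smul, map_smul, map_smul]
      simp
    | @path y' z q =>
    induction w using path_induction with
    | zero => simp
    | add z z' h h' =>
      rw [mul_add, map_add, h, h', MulOpposite.op_add, TensorProduct.tmul_add, map_add, map_add,
        map_add]
      simp only [LinearMap.add_apply]
      abel
    | smul c z h =>
      rw [mul_smul_comm, map_smul, h, MulOpposite.op_smul, TensorProduct.tmul_smul, map_smul,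
        map_smul, map_smul]
      simp
    | @path x y p =>
    by_cases h : y = y'
    · subst h
      rw [ofPath_mul_ofPath, hδ, hδ, hδ, pathDerivation_comp ρ m hm]
    · rw [ofPath_mul_ofPath_of_ne k h, hδ, hδ, map_zero, ← rho_vertex_pathDerivation ρ m hm p,
        ← rho_op_vertex_pathDerivation ρ m q, rho_rho, rho_rho]
      simp [← op_mul, ← ofPath_nil, ofPath_mul_ofPath_of_ne k h]
  · rw [← ofPath_toPath, hδ]
    change ρ _ 0 + ρ _ (m a) = m a
    rw [map_zero, zero_add, ← hm a, rho_rho, ofPath_nil]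
    simp [← op_mul, vertex_mul_vertex]

end Derivation

end QuiverAlgebra

/-! ### The standard presentation of a quotient of a quiver algebra -/

/-- The set `Q₁` of all arrows; `a.1` is the source and `a.2.1` the target of the arrow `a`. -/
abbrev Quiver.Arrows (V : Type v) [Quiver.{w} V] : Type (max v w) := Σ x y : V, x ⟶ y

section Invariants

variable (k : Type u) [Field k] {A : Type v} [Ring A] [Algebra k A]

/-- The instance of `zero_smul` for the enveloping algebra, stated for the zero of the tensor
product. -/
lemma envelope_zero_smul {X : Type*} [AddCommGroup X] [Module (Envelope k A) X] (x : X) :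
    (0 : A ⊗[k] Aᵐᵒᵖ) • x = 0 :=
  Module.zero_smul (R := Envelope k A) x

variable (A) in
/-- The identity, from `A` to the bimodule `A`. -/
noncomputable def toRegular : A ≃+ regularBimodule k A := AddEquiv.refl A

lemma tmul_smul_toRegular (a b z : A) :
    (a ⊗ₜ[k] op b : Envelope k A) • toRegular k A z = toRegular k A (a * z * b) :=
  congrArg (toRegular k A) (mul_assoc a z b).symm

variable {k} in
lemma mem_bimoduleInvariants {X : ModuleCat.{w} (Envelope k A)} {m : X} :
    m ∈ bimoduleInvariants k X ↔
      ∀ a : A, (a ⊗ₜ[k] (1 : Aᵐᵒᵖ) : Envelope k A) • m = (1 ⊗ₜ[k] op a : Envelope k A) • m := by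
  simp [bimoduleInvariants, sub_eq_zero]

/-- An invariant element `m` of `X` defines the morphism of bimodules `A → X`, `a ↦ a m`. -/
noncomputable def homOfInvariant {X : ModuleCat.{w} (Envelope k A)} (m : X)
    (hm : m ∈ bimoduleInvariants k X) :
    regularBimodule k A →ₗ[Envelope k A] X where
  toFun z := ((toRegular k A).symm z ⊗ₜ[k] (1 : Aᵐᵒᵖ) : Envelope k A) • m
  map_add' z w := by rw [map_add, TensorProduct.add_tmul, add_smul]
  map_smul' r z := by
    obtain ⟨z, rfl⟩ := (toRegular k A).surjective z
    rw [RingHom.id_apply, AddEquiv.symm_apply_apply]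
    induction r using TensorProduct.induction_on with
    | zero =>
      rw [envelope_zero_smul, envelope_zero_smul, map_zero, TensorProduct.zero_tmul,
        envelope_zero_smul]
    | add r s hr hs => rw [add_smul, map_add, TensorProduct.add_tmul, add_smul, hr, hs, add_smul]
    | tmul a b =>
      obtain ⟨b, rfl⟩ := op_surjective b
      have h : ((a * z * b) ⊗ₜ[k] (1 : Aᵐᵒᵖ) : Envelope k A) =
          ((a * z) ⊗ₜ[k] (1 : Aᵐᵒᵖ)) * (b ⊗ₜ[k] 1) := by simp
      rw [tmul_smul_toRegular, AddEquiv.symm_apply_apply, h, mul_smul,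
        mem_bimoduleInvariants.mp hm, ← mul_smul, ← mul_smul]
      simp

lemma homOfInvariant_toRegular {X : ModuleCat.{w} (Envelope k A)} (m : X)
    (hm : m ∈ bimoduleInvariants k X) (z : A) :
    homOfInvariant k m hm (toRegular k A z) = (z ⊗ₜ[k] (1 : Aᵐᵒᵖ) : Envelope k A) • m :=
  rfl

/-- `Hom(A, X) = X^A`. -/
noncomputable def homRegularEquiv (X : ModuleCat.{w} (Envelope k A)) :
    (regularBimodule k A →ₗ[Envelope k A] X) ≃ₗ[k] bimoduleInvariants k X where
  toFun f := ⟨f (toRegular k A 1), mem_bimoduleInvariants.mpr fun a => by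
    rw [← map_smul f, ← map_smul f, ← op_one, tmul_smul_toRegular, tmul_smul_toRegular]
    simp⟩
  map_add' _ _ := rfl
  map_smul' _ _ := rfl
  invFun m := homOfInvariant k m.1 m.2
  left_inv f := LinearMap.ext fun z => by
    obtain ⟨z, rfl⟩ := (toRegular k A).surjective z
    rw [homOfInvariant_toRegular, ← map_smul f, ← op_one, tmul_smul_toRegular, mul_one, mul_one]
  right_inv m := Subtype.ext (by
    change homOfInvariant k m.1 m.2 (toRegular k A 1) = m
    rw [homOfInvariant_toRegular, ← Algebra.TensorProduct.one_def, one_smul])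

end Invariants

namespace QuiverPresentation

open QuiverAlgebra IdempotentModule

variable {k : Type u} {V : Type v} [Field k] [Quiver.{w} V] [Fintype V]
  {A : Type (max u v w)} [Ring A] [Algebra k A] (φ : QuiverAlgebra k V →ₐ[k] A)

/-- The idempotent `x ⊗ x` of the enveloping algebra. -/
noncomputable def vertexIdem (x : V) : Envelope k A := φ (vertex k x) ⊗ₜ op (φ (vertex k x))

/-- The idempotent `t(a) ⊗ s(a)` of the enveloping algebra. -/
noncomputable def arrowIdem (a : Quiver.Arrows V) : Envelope k A :=
  φ (vertex k a.2.1) ⊗ₜ op (φ (vertex k a.1))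

lemma isIdempotentElem_tmul (x y : V) : IsIdempotentElem
    (φ (vertex k y) ⊗ₜ[k] op (φ (vertex k x)) : Envelope k A) := by
  rw [IsIdempotentElem, Algebra.TensorProduct.tmul_mul_tmul, ← op_mul, ← map_mul, ← map_mul,
    vertex_mul_vertex, vertex_mul_vertex]

lemma isIdempotentElem_vertexIdem (x : V) : IsIdempotentElem (vertexIdem φ x) :=
  isIdempotentElem_tmul φ x x

lemma isIdempotentElem_arrowIdem (a : Quiver.Arrows V) : IsIdempotentElem (arrowIdem φ a) :=
  isIdempotentElem_tmul φ a.1 a.2.1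

/-- The generator `x ⊗ x` of the projective bimodule `P₀ = ⨁ₓ A x ⊗ x A`. -/
noncomputable abbrev vertexGen (x : V) : IdempotentModule (vertexIdem φ) :=
  gen (isIdempotentElem_vertexIdem φ) x

/-- The generator `t(a) ⊗ s(a)` of the projective bimodule `P₁ = ⨁ₐ A t(a) ⊗ s(a) A`. -/
noncomputable abbrev arrowGen (a : Quiver.Arrows V) : IdempotentModule (arrowIdem φ) :=
  gen (isIdempotentElem_arrowIdem φ) a

/-- The left action of an arrow, as an element of the enveloping algebra. -/
noncomputable def leftArrow (a : Quiver.Arrows V) : Envelope k A := φ (arrow k a.2.2) ⊗ₜ 1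

/-- The right action of an arrow, as an element of the enveloping algebra. -/
noncomputable def rightArrow (a : Quiver.Arrows V) : Envelope k A := 1 ⊗ₜ op (φ (arrow k a.2.2))

lemma arrowIdem_mul_leftArrow (a : Quiver.Arrows V) :
    arrowIdem φ a * leftArrow φ a = leftArrow φ a * vertexIdem φ a.1 := by
  simp [arrowIdem, leftArrow, vertexIdem, ← map_mul, vertex_mul_arrow, arrow_mul_vertex]

lemma arrowIdem_mul_rightArrow (a : Quiver.Arrows V) :
    arrowIdem φ a * rightArrow φ a = rightArrow φ a * vertexIdem φ a.2.1 := by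
  simp [arrowIdem, rightArrow, vertexIdem, ← map_mul, ← op_mul, vertex_mul_arrow, arrow_mul_vertex]

/-- The element `a ⊗ s(a) - t(a) ⊗ a` of `P₀`. -/
noncomputable def boundary (a : Quiver.Arrows V) : IdempotentModule (vertexIdem φ) :=
  leftArrow φ a • vertexGen φ a.1 - rightArrow φ a • vertexGen φ a.2.1

lemma arrowIdem_smul_boundary (a : Quiver.Arrows V) :
    arrowIdem φ a • boundary φ a = boundary φ a := by
  rw [boundary, smul_sub, ← mul_smul, ← mul_smul, arrowIdem_mul_leftArrow,
    arrowIdem_mul_rightArrow, mul_smul, mul_smul, idempotent_smul_gen, idempotent_smul_gen]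

/-- The augmentation `P₀ → A`, `p ⊗ q ↦ p q`. -/
noncomputable def augmentation :
    IdempotentModule (vertexIdem φ) →ₗ[Envelope k A] regularBimodule k A :=
  lift (vertexIdem φ) fun x => toRegular k A (φ (vertex k x))

lemma augmentation_vertexGen (x : V) :
    augmentation φ (vertexGen φ x) = toRegular k A (φ (vertex k x)) := by
  rw [augmentation, lift_gen, vertexIdem, tmul_smul_toRegular, ← map_mul, ← map_mul,
    vertex_mul_vertex, vertex_mul_vertex]

lemma augmentation_boundary (a : Quiver.Arrows V) : augmentation φ (boundary φ a) = 0 := by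
  rw [boundary, map_sub, map_smul, map_smul, augmentation_vertexGen, augmentation_vertexGen,
    leftArrow, rightArrow, ← op_one, tmul_smul_toRegular, tmul_smul_toRegular, mul_one, one_mul,
    ← map_mul, ← map_mul, vertex_mul_arrow, arrow_mul_vertex, sub_self]

lemma augmentation_surjective : Function.Surjective (augmentation φ) := by
  intro z
  obtain ⟨z, rfl⟩ := (toRegular k A).surjective z
  refine ⟨(z ⊗ₜ[k] op (1 : A) : Envelope k A) • ∑ x, vertexGen φ x, ?_⟩
  have h : ∑ x, augmentation φ (vertexGen φ x) = toRegular k A 1 := by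
    simp_rw [augmentation_vertexGen]
    rw [← map_one φ, one_def, map_sum, map_sum]
  rw [map_smul, map_sum, h, tmul_smul_toRegular, mul_one, mul_one]

/-- A bimodule morphism out of `P₀` that vanishes on the elements `a ⊗ s(a) - t(a) ⊗ a` is given by
elements of the spaces `x X x` whose sum commutes with the vertices and the arrows, hence with `A`,
so it factors through the augmentation. -/
lemma exists_factorization_augmentation (hφ : Function.Surjective φ)
    (X : ModuleCat.{max u v w} (Envelope k A))
    (π : IdempotentModule (vertexIdem φ) →ₗ[Envelope k A] X) (hπ₀ : ∀ a, π (boundary φ a) = 0) :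
    ∃ g : regularBimodule k A →ₗ[Envelope k A] X, g ∘ₗ augmentation φ = π := by
  have hπ : ∀ a, leftArrow φ a • π (vertexGen φ a.1) = rightArrow φ a • π (vertexGen φ a.2.1) := by
    intro a
    rw [← sub_eq_zero, ← map_smul, ← map_smul, ← map_sub]
    exact hπ₀ a
  have hidem : ∀ x, vertexIdem φ x • π (vertexGen φ x) = π (vertexGen φ x) := fun x => by
    rw [← map_smul, idempotent_smul_gen]
  let m : X := ∑ x, π (vertexGen φ x)
  have hne : ∀ {x y}, x ≠ y → (φ (vertex k x) ⊗ₜ[k] 1 : Envelope k A) • π (vertexGen φ y) = 0 ∧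
      (1 ⊗ₜ[k] op (φ (vertex k x)) : Envelope k A) • π (vertexGen φ y) = 0 := fun {x y} h => by
    rw [← hidem, ← mul_smul, ← mul_smul, vertexIdem, Algebra.TensorProduct.tmul_mul_tmul,
      Algebra.TensorProduct.tmul_mul_tmul, ← op_mul, ← map_mul, ← map_mul,
      vertex_mul_vertex_of_ne k h, vertex_mul_vertex_of_ne k h.symm, map_zero, op_zero,
      TensorProduct.zero_tmul, TensorProduct.tmul_zero, envelope_zero_smul]
    exact ⟨rfl, rfl⟩
  have hl : ∀ x, (φ (vertex k x) ⊗ₜ[k] 1 : Envelope k A) • m = π (vertexGen φ x) := fun x => by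
    rw [Finset.smul_sum, Finset.sum_eq_single x (fun y _ h => (hne h.symm).1) (by simp), ← hidem,
      ← mul_smul, vertexIdem, Algebra.TensorProduct.tmul_mul_tmul, ← map_mul, vertex_mul_vertex,
      one_mul]
  have hr : ∀ x, (1 ⊗ₜ[k] op (φ (vertex k x)) : Envelope k A) • m = π (vertexGen φ x) := fun x => by
    rw [Finset.smul_sum, Finset.sum_eq_single x (fun y _ h => (hne h.symm).2) (by simp), ← hidem,
      ← mul_smul, vertexIdem, Algebra.TensorProduct.tmul_mul_tmul, ← op_mul, ← map_mul,
      vertex_mul_vertex, one_mul]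
  have hm : m ∈ bimoduleInvariants k X := by
    refine mem_bimoduleInvariants.mpr fun z => ?_
    obtain ⟨z, rfl⟩ := hφ z
    induction z using generator_induction with
    | vertex x => rw [hl, hr]
    | @arrow x y a =>
      have h1 : (φ (arrow k a) ⊗ₜ[k] 1 : Envelope k A) • m =
          leftArrow φ ⟨x, y, a⟩ • π (vertexGen φ x) := by
        rw [← hl, ← mul_smul, leftArrow, Algebra.TensorProduct.tmul_mul_tmul, ← map_mul,
          arrow_mul_vertex, one_mul]
      have h2 : (1 ⊗ₜ[k] op (φ (arrow k a)) : Envelope k A) • m =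
          rightArrow φ ⟨x, y, a⟩ • π (vertexGen φ y) := by
        rw [← hr, ← mul_smul, rightArrow, Algebra.TensorProduct.tmul_mul_tmul, ← op_mul, ← map_mul,
          vertex_mul_arrow, one_mul]
      rw [h1, h2]
      exact hπ ⟨x, y, a⟩
    | zero => simp
    | add z w hz hw =>
      rw [map_add, TensorProduct.add_tmul, MulOpposite.op_add, TensorProduct.tmul_add, add_smul,
        add_smul, hz, hw]
    | smul c z hz =>
      rw [map_smul, MulOpposite.op_smul, TensorProduct.tmul_smul, ← TensorProduct.smul_tmul',
        smul_assoc, smul_assoc, hz]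
    | mul z w hz hw =>
      have h1 : (φ (z * w) ⊗ₜ[k] 1 : Envelope k A) = φ z ⊗ₜ 1 * φ w ⊗ₜ 1 := by simp
      have h2 : (1 ⊗ₜ[k] op (φ (z * w)) : Envelope k A) = 1 ⊗ₜ op (φ w) * 1 ⊗ₜ op (φ z) := by
        simp
      have h3 : (φ z ⊗ₜ[k] 1 * 1 ⊗ₜ op (φ w) : Envelope k A) = 1 ⊗ₜ op (φ w) * φ z ⊗ₜ 1 := by simp
      rw [h1, h2, mul_smul, hw, ← mul_smul, h3, mul_smul, hz, ← mul_smul]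
  refine ⟨homOfInvariant k m hm, hom_ext (isIdempotentElem_vertexIdem φ) fun x => ?_⟩
  rw [LinearMap.comp_apply, augmentation_vertexGen, homOfInvariant_toRegular, hl]

variable [∀ x y : V, Fintype (x ⟶ y)]

/-- The differential `P₁ → P₀`, `t(a) ⊗ s(a) ↦ a ⊗ s(a) - t(a) ⊗ a`. -/
noncomputable def differential :
    IdempotentModule (arrowIdem φ) →ₗ[Envelope k A] IdempotentModule (vertexIdem φ) :=
  lift (arrowIdem φ) (boundary φ)

lemma differential_arrowGen (a : Quiver.Arrows V) :
    differential φ (arrowGen φ a) = boundary φ a := by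
  rw [differential, lift_gen, arrowIdem_smul_boundary]

lemma differential_apply (f : IdempotentModule (arrowIdem φ)) :
    differential φ f = ∑ a, coord a f • boundary φ a :=
  lift_apply _ f

lemma augmentation_differential (f : IdempotentModule (arrowIdem φ)) :
    augmentation φ (differential φ f) = 0 := by
  rw [differential_apply, map_sum]
  exact Finset.sum_eq_zero fun a _ => by rw [map_smul, augmentation_boundary, smul_zero]

/-- The sequence `P₁ → P₀ → A` is exact: the projection of `P₀` onto the cokernel of the
differential factors through the augmentation. -/
lemma exact_differential_augmentation (hφ : Function.Surjective φ) :
    Function.Exact (differential φ) (augmentation φ) := by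
  refine fun p => ⟨fun hp => ?_, fun ⟨f, hf⟩ => hf ▸ augmentation_differential φ f⟩
  obtain ⟨g, hg⟩ := exists_factorization_augmentation φ hφ
    (ModuleCat.of _ (IdempotentModule (vertexIdem φ) ⧸ LinearMap.range (differential φ)))
    (LinearMap.range (differential φ)).mkQ fun a =>
      (Submodule.Quotient.mk_eq_zero _).mpr ⟨arrowGen φ a, differential_arrowGen φ a⟩
  have hp0 := LinearMap.congr_fun hg p
  rw [LinearMap.comp_apply, hp, map_zero] at hp0
  exact (Submodule.Quotient.mk_eq_zero _).mp hp0.symm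

end QuiverPresentation

/-! ### The dimension formula -/

/-- The cardinal sum of a finite family is its `Finset` sum. -/
lemma Cardinal.sum_eq_of_fintype {α : Type u} [h : Fintype α] (f : α → Cardinal.{v}) :
    Cardinal.sum f = Cardinal.lift.{u} (∑ i, f i) := by
  revert f
  refine Fintype.induction_empty_option ?_ ?_ ?_ α (h_fintype := h)
  · intro α β hβ e h f
    let := Fintype.ofEquiv β e.symm
    rw [← e.sum_comp f, ← h]
    exact Cardinal.mk_congr (e.sigmaCongrLeft (β := fun b => (f b).out)).symm
  · intro f
    rw [Fintype.univ_pempty, Finset.sum_empty, Cardinal.lift_zero, Cardinal.sum,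
      Cardinal.mk_eq_zero]
  · intro α hα h f
    let E : (Σ i : Option α, (f i).out) ≃ (f none).out ⊕ Σ i : α, (f (some i)).out :=
      { toFun := fun p => match p with
          | ⟨none, x⟩ => Sum.inl x
          | ⟨some i, x⟩ => Sum.inr ⟨i, x⟩
        invFun := fun p => match p with
          | Sum.inl x => ⟨none, x⟩
          | Sum.inr ⟨i, x⟩ => ⟨some i, x⟩
        left_inv := by rintro ⟨_ | i, x⟩ <;> rfl
        right_inv := by rintro (x | ⟨i, x⟩) <;> rfl }
    rw [Cardinal.sum, Cardinal.mk_congr E, Cardinal.mk_sum, Cardinal.mk_out, ← Cardinal.sum,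
      h fun i => f (some i), Fintype.sum_option, Cardinal.lift_add]
    simp
    rw [Cardinal.lift_umax.{v, u}]

namespace QuiverPresentation

open QuiverAlgebra IdempotentModule

variable {k : Type u} {V : Type v} [Field k] [Quiver.{w} V] [Fintype V]
  {A : Type (max u v w)} [Ring A] [Algebra k A] (φ : QuiverAlgebra k V →ₐ[k] A)

section Contraction

variable {B : Type v} [Ring B] [Algebra k B]
  {X : Type*} [AddCommGroup X] [Module k X] (ρ : Envelope k B →ₐ[k] Module.End k X)
  (δ : B →ₗ[k] X)

/-- The linear map `B ⊗ Bᵒᵖ → X`, `p ⊗ q ↦ δ(p) q`. -/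
noncomputable def contraction : Envelope k B →ₗ[k] X :=
  TensorProduct.lift (LinearMap.mk₂ k (fun z w => ρ (1 ⊗ₜ w) (δ z))
    (fun z z' w => by simp) (fun c z w => by simp)
    (fun z w w' => by simp [TensorProduct.tmul_add]) (fun c z w => by simp))

lemma contraction_tmul (z : B) (w : Bᵐᵒᵖ) : contraction ρ δ (z ⊗ₜ w) = ρ (1 ⊗ₜ w) (δ z) :=
  rfl

/-- If `δ` is a derivation, then `δ(p b) q - δ(p) b q = p δ(b) q`. -/
lemma contraction_mul_sub (hδ : ∀ z w, δ (z * w) = ρ (z ⊗ₜ 1) (δ w) + ρ (1 ⊗ₜ op w) (δ z))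
    (r : Envelope k B) (b : B) :
    contraction ρ δ (r * b ⊗ₜ 1) - contraction ρ δ (r * 1 ⊗ₜ op b) = ρ r (δ b) := by
  induction r using TensorProduct.induction_on with
  | zero => simp
  | add r s hr hs =>
    rw [map_add, LinearMap.add_apply, ← hr, ← hs, add_mul, add_mul, map_add, map_add]
    abel
  | tmul p q =>
    rw [Algebra.TensorProduct.tmul_mul_tmul, Algebra.TensorProduct.tmul_mul_tmul, contraction_tmul,
      contraction_tmul, hδ, map_add, ← Module.End.mul_apply, ← Module.End.mul_apply, ← map_mul,
      ← map_mul]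
    simp

end Contraction

section TotalContraction

variable {X : Type*} [AddCommGroup X] [Module k X] (ρ : Envelope k A →ₐ[k] Module.End k X)
  (δ : A →ₗ[k] X)

/-- The additive map `P₀ → X`, `p ⊗ q ↦ δ(p) q`. -/
noncomputable def totalContraction : IdempotentModule (vertexIdem φ) →+ X :=
  ∑ x, (contraction ρ δ).toAddMonoidHom.comp (coord x).toAddMonoidHom

lemma totalContraction_smul_vertexGen (r : Envelope k A) (x : V) :
    totalContraction φ ρ δ (r • vertexGen φ x) = contraction ρ δ (r * vertexIdem φ x) := by
  rw [totalContraction, AddMonoidHom.finsetSum_apply, Finset.sum_eq_single x]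
  · change contraction ρ δ (coord x (r • vertexGen φ x)) = _
    rw [map_smul, coord_gen, smul_eq_mul]
  · intro y _ h
    change contraction ρ δ (coord y (r • vertexGen φ x)) = _
    rw [map_smul, coord_gen_of_ne _ h, smul_zero, map_zero]
  · simp

variable [∀ x y : V, Fintype (x ⟶ y)]

/-- The contraction of a derivation `δ`, composed with the differential, is the bimodule morphism
`P₁ → X` which maps `t(a) ⊗ s(a)` to `δ(a)`. -/
lemma totalContraction_differential
    (hδ : ∀ z w, δ (z * w) = ρ (z ⊗ₜ 1) (δ w) + ρ (1 ⊗ₜ op w) (δ z))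
    (f : IdempotentModule (arrowIdem φ)) :
    totalContraction φ ρ δ (differential φ f) =
      ∑ a, ρ (coord a f) (δ (φ (arrow k a.2.2))) := by
  rw [differential_apply, map_sum]
  refine Finset.sum_congr rfl fun a _ => ?_
  rw [boundary, smul_sub, ← mul_smul, ← mul_smul, map_sub, totalContraction_smul_vertexGen,
    totalContraction_smul_vertexGen, mul_assoc, mul_assoc, ← arrowIdem_mul_leftArrow,
    ← arrowIdem_mul_rightArrow, ← mul_assoc, ← mul_assoc, coord_mul, leftArrow, rightArrow,
    contraction_mul_sub ρ δ hδ]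

end TotalContraction

variable [∀ x y : V, Fintype (x ⟶ y)]

/-- The alternating sum of the dimensions in the exact sequence
`0 → X^A → Hom(P₀, X) → Hom(P₁, X) → Coker → 0`. -/
lemma rank_homCokernel_add (hφ : Function.Surjective φ) (X : ModuleCat.{max u v w} (Envelope k A)) :
    Module.rank k (HomCokernel k (differential φ) X) +
        ∑ x : V, Module.rank k (bimoduleCorner k X (φ (vertex k x)) (φ (vertex k x))) =
      Module.rank k (bimoduleInvariants k X) + ∑ a : Quiver.Arrows V,
        Module.rank k (bimoduleCorner k X (φ (vertex k a.2.1)) (φ (vertex k a.1))) := by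
  have h0 : Module.rank k (IdempotentModule (vertexIdem φ) →ₗ[Envelope k A] X) =
      ∑ x : V, Module.rank k (bimoduleCorner k X (φ (vertex k x)) (φ (vertex k x))) := by
    rw [(homEquiv k (isIdempotentElem_vertexIdem φ) X).rank_eq, rank_pi,
      Cardinal.sum_eq_of_fintype, Cardinal.lift_id'.{v, max u v w}]
    rfl
  have h1 : Module.rank k (IdempotentModule (arrowIdem φ) →ₗ[Envelope k A] X) =
      ∑ a : Quiver.Arrows V,
        Module.rank k (bimoduleCorner k X (φ (vertex k a.2.1)) (φ (vertex k a.1))) := by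
    rw [(homEquiv k (isIdempotentElem_arrowIdem φ) X).rank_eq, rank_pi,
      Cardinal.sum_eq_of_fintype, Cardinal.lift_id'.{max v w, max u v w}]
    rfl
  have hinj : Function.Injective (homRestrict k (augmentation φ) X) := fun f g hfg =>
    LinearMap.ext fun z => by
      obtain ⟨p, rfl⟩ := augmentation_surjective φ z
      exact LinearMap.congr_fun hfg p
  have hker : LinearMap.ker (homRestrict k (differential φ) X) =
      LinearMap.range (homRestrict k (augmentation φ) X) := by
    ext π
    constructor
    · intro hπ
      obtain ⟨g, hg⟩ := exists_factorization_augmentation φ hφ X π fun a => by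
        rw [← differential_arrowGen]
        exact LinearMap.congr_fun hπ (arrowGen φ a)
      exact ⟨g, hg⟩
    · rintro ⟨g, rfl⟩
      refine LinearMap.ext fun f => ?_
      change g (augmentation φ (differential φ f)) = 0
      rw [augmentation_differential, map_zero]
  have h2 : Module.rank k (LinearMap.ker (homRestrict k (differential φ) X)) =
      Module.rank k (bimoduleInvariants k X) := by
    rw [hker, ← (LinearEquiv.ofInjective _ hinj).rank_eq, (homRegularEquiv k X).rank_eq]
  have h3 := LinearMap.rank_range_add_rank_ker (homRestrict k (differential φ) X)
  have h4 := Submodule.rank_quotient_add_rank (LinearMap.range (homRestrict k (differential φ) X))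
  rw [← h0, ← h1, ← h2, ← h3, ← h4]
  ring

/-! ### The resolution of a quiver algebra -/

/-- For `kQ` itself, every bimodule morphism `P₁ → X` extends along the differential to an additive
map `P₀ → X`, the contraction of the derivation that takes the given values on the arrows. -/
lemma exists_extension_differential (X : ModuleCat.{max u v w} (Envelope k (QuiverAlgebra k V)))
    (m : Quiver.Arrows V → X)
    (hm : ∀ a, arrowIdem (AlgHom.id k (QuiverAlgebra k V)) a • m a = m a) :
    ∃ h : IdempotentModule (vertexIdem (AlgHom.id k (QuiverAlgebra k V))) →+ X,
      ∀ f, h (differential _ f) = lift _ m f := by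
  let ρ : Envelope k (QuiverAlgebra k V) →ₐ[k] Module.End k X := Algebra.lsmul k k X
  obtain ⟨δ, hδ, hδ'⟩ := exists_derivation (k := k) (V := V) ρ
    (fun {x y} a => m ⟨x, y, a⟩) (fun {x y} a => hm ⟨x, y, a⟩)
  refine ⟨totalContraction (AlgHom.id k (QuiverAlgebra k V)) ρ δ, fun f => ?_⟩
  rw [totalContraction_differential (AlgHom.id k (QuiverAlgebra k V)) ρ δ hδ, lift_apply]
  exact Finset.sum_congr rfl fun a _ => congrArg (coord a f • ·) (hδ' a.2.2)

/-- For `kQ` itself the differential is injective, because the identity of `P₁` extends to `P₀`. -/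
lemma differential_injective :
    Function.Injective (differential (AlgHom.id k (QuiverAlgebra k V))) := by
  have he := isIdempotentElem_arrowIdem (AlgHom.id k (QuiverAlgebra k V))
  obtain ⟨h, hh⟩ := exists_extension_differential (k := k) (V := V)
    (ModuleCat.of _ (IdempotentModule (arrowIdem (AlgHom.id k (QuiverAlgebra k V)))))
    (gen he) (idempotent_smul_gen he)
  refine Function.LeftInverse.injective (g := h) fun f => (hh f).trans ?_
  exact (lift_apply _ f).trans (sum_smul_gen he f)

/-- The exact sequence `0 → P₁ → P₀ → kQ → 0` computes the first Hochschild cohomology of `kQ`. -/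
lemma nonempty_homCokernel_equiv_hochschild
    (X : ModuleCat.{max u v w} (Envelope k (QuiverAlgebra k V))) :
    Nonempty (HomCokernel k (differential (AlgHom.id k (QuiverAlgebra k V))) X ≃ₗ[k]
      HochschildCohomology k (QuiverAlgebra k V) X 1) := by
  let φ := AlgHom.id k (QuiverAlgebra k V)
  let S : ShortComplex (ModuleCat.{max u v w} (Envelope k (QuiverAlgebra k V))) :=
    ShortComplex.mk (ModuleCat.ofHom (differential φ)) (ModuleCat.ofHom (augmentation φ))
      (by ext f; exact augmentation_differential φ f)
  have hS : S.ShortExact :=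
    { exact := (ShortComplex.ShortExact.moduleCat_exact_iff_function_exact S).mpr
        (exact_differential_augmentation φ Function.surjective_id)
      mono_f := (ModuleCat.mono_iff_injective _).mpr differential_injective
      epi_g := (ModuleCat.epi_iff_surjective _).mpr (augmentation_surjective φ) }
  have : Projective S.X₂ :=
    (IsProjective.iff_projective _).mp (projective (isIdempotentElem_vertexIdem φ))
  exact nonempty_homCokernel_equiv_ext k S hS X

lemma rank_hochschildCohomology_add (X : ModuleCat.{max u v w} (Envelope k (QuiverAlgebra k V))) :
    Module.rank k (HochschildCohomology k (QuiverAlgebra k V) X 1) +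
        ∑ x : V, Module.rank k (bimoduleCorner k X (vertex k x) (vertex k x)) =
      Module.rank k (bimoduleInvariants k X) + ∑ a : Quiver.Arrows V,
        Module.rank k (bimoduleCorner k X (vertex k a.2.1) (vertex k a.1)) := by
  obtain ⟨e⟩ := nonempty_homCokernel_equiv_hochschild X
  rw [← e.rank_eq]
  exact rank_homCokernel_add (AlgHom.id k (QuiverAlgebra k V)) Function.surjective_id X

end QuiverPresentation

/-! ### Characters of a quiver algebra and the arrow ideal -/

namespace QuiverAlgebra

variable (k : Type u) {V : Type v} [Field k] [Quiver.{w} V] [Fintype V]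

/-- The product of two paths is a path, whose length is the sum of their lengths, or `0`. -/
lemma ofPath_mul_ofPath_cases {x y x' y' : V} (q : Quiver.Path x' y') (p : Quiver.Path x y) :
    ofPath k q * ofPath k p = 0 ∨ ∃ r : Quiver.Path x y', r.length = q.length + p.length ∧
      ofPath k q * ofPath k p = ofPath k r := by
  by_cases h : y = x'
  · subst h
    exact Or.inr ⟨p.comp q, by rw [Quiver.Path.length_comp, add_comm], ofPath_mul_ofPath k q p⟩
  · exact Or.inl (ofPath_mul_ofPath_of_ne k h q p)

open Classical in
/-- The linear form on `kQ` that is `1` at the path of length `0` at the vertex `x` and `0` at all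
other paths. -/
noncomputable def vertexForm (x : V) : QuiverAlgebra k V →ₗ[k] k :=
  (pathBasis k V).constr k fun p => if p.path.length = 0 ∧ p.source = x then 1 else 0

open Classical in
lemma vertexForm_ofPath (x : V) {y z : V} (p : Quiver.Path y z) :
    vertexForm k x (ofPath k p) = if p.length = 0 ∧ y = x then 1 else 0 := by
  simp [vertexForm, ofPath]

lemma vertexForm_mul (x : V) (z w : QuiverAlgebra k V) :
    vertexForm k x (z * w) = vertexForm k x z * vertexForm k x w := by
  induction z using path_induction with
  | zero => simp
  | add z z' h h' => rw [add_mul, map_add, h, h', map_add, add_mul]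
  | smul c z h => rw [smul_mul_assoc, map_smul, h, map_smul, smul_mul_assoc]
  | @path a b q =>
  induction w using path_induction with
  | zero => simp
  | add z z' h h' => rw [mul_add, map_add, h, h', map_add, mul_add]
  | smul c z h => rw [mul_smul_comm, map_smul, h, map_smul, mul_smul_comm]
  | @path c d p =>
  by_cases h : d = a
  · subst h
    rw [ofPath_mul_ofPath, vertexForm_ofPath, vertexForm_ofPath, vertexForm_ofPath,
      Quiver.Path.length_comp]
    by_cases hp : p.length = 0
    · have := Quiver.Path.eq_of_length_zero p hp
      subst this
      by_cases hq : q.length = 0 <;> by_cases hx : c = x <;> simp [hp, hq, hx]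
    · simp [hp]
  · rw [ofPath_mul_ofPath_of_ne k h, map_zero, vertexForm_ofPath, vertexForm_ofPath]
    by_cases hp : p.length = 0
    · have := Quiver.Path.eq_of_length_zero p hp
      subst this
      by_cases hx : c = x
      · subst hx
        simp [Ne.symm h]
      · simp [hx]
    · simp [hp]

/-- The character of `kQ` at a vertex, which maps all arrows to `0`. -/
noncomputable def vertexCharacter (x : V) : QuiverAlgebra k V →ₐ[k] k :=
  AlgHom.ofLinearMap (vertexForm k x)
    (by
      classical
      rw [one_def, map_sum, Finset.sum_eq_single x]
      · rw [← ofPath_nil, vertexForm_ofPath]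
        simp
      · intro y _ h
        rw [← ofPath_nil, vertexForm_ofPath]
        simp [h]
      · simp)
    (vertexForm_mul k x)

open Classical in
lemma vertexCharacter_ofPath (x : V) {y z : V} (p : Quiver.Path y z) :
    vertexCharacter k x (ofPath k p) = if p.length = 0 ∧ y = x then 1 else 0 :=
  vertexForm_ofPath k x p

open Classical in
lemma vertexCharacter_vertex (x y : V) :
    vertexCharacter k x (vertex k y) = if y = x then 1 else 0 := by
  rw [← ofPath_nil, vertexCharacter_ofPath]
  simp

lemma vertexCharacter_eq_zero_of_mem (x : V) {z : QuiverAlgebra k V} (hz : z ∈ arrowIdeal k V) :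
    vertexCharacter k x z = 0 := by
  have h : TwoSidedIdeal.span {z | ∃ (x y : V) (a : x ⟶ y), z = arrow k a} ≤
      TwoSidedIdeal.ker (vertexCharacter k x) := by
    refine TwoSidedIdeal.span_le.mpr ?_
    rintro _ ⟨y, y', a, rfl⟩
    refine (TwoSidedIdeal.mem_ker _).mpr ?_
    rw [← ofPath_toPath, vertexCharacter_ofPath]
    simp
  exact (TwoSidedIdeal.mem_ker _).mp (h hz)

lemma arrow_mem_arrowIdeal {x y : V} (a : x ⟶ y) : arrow k a ∈ arrowIdeal k V :=
  TwoSidedIdeal.subset_span ⟨x, y, a, rfl⟩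

instance : (arrowIdeal k V).IsTwoSided :=
  inferInstanceAs (TwoSidedIdeal.asIdeal _).IsTwoSided

lemma ofPath_mem_arrowIdeal_pow {n : ℕ} {x y : V} (p : Quiver.Path x y) (h : n ≤ p.length) :
    ofPath k p ∈ arrowIdeal k V ^ n := by
  induction n generalizing y with
  | zero =>
    rw [Submodule.pow_zero, Ideal.one_eq_top]
    trivial
  | succ n ih =>
    cases p with
    | nil => simp at h
    | cons p a =>
      rw [ofPath_cons, Ideal.IsTwoSided.pow_succ]
      exact Ideal.mul_mem_mul (arrow_mem_arrowIdeal k a)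
        (ih p (by simpa using h))

/-- A linear map that vanishes on the products of two elements of `F` vanishes on `F²`. -/
lemma eq_zero_of_mem_arrowIdeal_sq {W : Type*} [AddCommGroup W] [Module k W]
    (f : QuiverAlgebra k V →ₗ[k] W)
    (hf : ∀ z ∈ arrowIdeal k V, ∀ w ∈ arrowIdeal k V, f (z * w) = 0)
    {z : QuiverAlgebra k V} (hz : z ∈ arrowIdeal k V ^ 2) : f z = 0 := by
  rw [Ideal.IsTwoSided.pow_succ, Submodule.pow_one] at hz
  induction hz using Submodule.smul_induction_on' with
  | smul z hz w hw => exact hf z hz w hw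
  | add z _ w _ hz hw => rw [map_add, hz, hw, add_zero]

/-- A quotient of `kQ` in which `Fⁿ` vanishes is finite dimensional: if `U` is the span of the
vertices and the arrows, then `U ^ (m + 1)` contains all paths of length at most `m + 1`. -/
lemma finite_of_surjective [∀ x y : V, Fintype (x ⟶ y)] {A : Type*} [Ring A] [Algebra k A]
    (φ : QuiverAlgebra k V →ₐ[k] A) (hφ : Function.Surjective φ) {n : ℕ}
    (hn : ∀ z ∈ arrowIdeal k V ^ n, φ z = 0) : FiniteDimensional k A := by
  let U : Submodule k (QuiverAlgebra k V) := Submodule.span k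
    (Set.range (vertex k) ∪ Set.range fun a : Quiver.Arrows V => arrow k a.2.2)
  have hU : U.FG := Submodule.fg_span ((Set.finite_range _).union (Set.finite_range _))
  have hv : ∀ x : V, vertex k x ∈ U := fun x => Submodule.subset_span (Or.inl ⟨x, rfl⟩)
  have ha : ∀ {x y : V} (a : x ⟶ y), arrow k a ∈ U := fun {x y} a =>
    Submodule.subset_span (Or.inr ⟨⟨x, y, a⟩, rfl⟩)
  have hp : ∀ m, ∀ {x y : V} (p : Quiver.Path x y), p.length ≤ m + 1 →
      ofPath k p ∈ U ^ (m + 1) := by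
    intro m
    induction m with
    | zero =>
      intro x y p h
      rw [zero_add, pow_one]
      cases p with
      | nil => exact hv _
      | cons p a =>
        cases p with
        | nil => exact ha a
        | cons p b => simp at h
    | succ m ih =>
      intro x y p h
      rw [pow_succ' U]
      cases p with
      | nil =>
        rw [ofPath_nil, ← vertex_mul_vertex]
        exact Submodule.mul_mem_mul (hv _) (ih Quiver.Path.nil (by simp))
      | cons p a =>
        rw [ofPath_cons]
        exact Submodule.mul_mem_mul (ha a) (ih p (by simpa using h))
  have htop : (U ^ (n + 1)).map φ.toLinearMap = ⊤ := by
    refine Submodule.eq_top_iff'.mpr fun z => ?_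
    obtain ⟨z, rfl⟩ := hφ z
    induction z using path_induction with
    | zero => rw [map_zero]; exact Submodule.zero_mem _
    | add z w hz hw => rw [map_add]; exact Submodule.add_mem _ hz hw
    | smul c z hz => rw [map_smul]; exact Submodule.smul_mem _ c hz
    | path p =>
      rcases le_total n p.length with h | h
      · rw [hn _ (ofPath_mem_arrowIdeal_pow k p h)]
        exact Submodule.zero_mem _
      · exact ⟨_, hp n p (by omega), rfl⟩
  exact ⟨htop ▸ (hU.pow (n + 1)).map _⟩

end QuiverAlgebra

/-! ### The radical of the enveloping algebra -/

section EnvelopeCharacter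

variable {k : Type u} [Field k] {B : Type v} [Ring B] [Algebra k B]

/-- The character `p ⊗ q ↦ χ₁(p) χ₂(q)` of the enveloping algebra. -/
noncomputable def envelopeCharacter (χ₁ χ₂ : B →ₐ[k] k) : Envelope k B →ₐ[k] k :=
  Algebra.TensorProduct.lift χ₁ (χ₂.fromOpposite fun _ _ => Commute.all _ _)
    fun _ _ => Commute.all _ _

lemma envelopeCharacter_tmul (χ₁ χ₂ : B →ₐ[k] k) (p q : B) :
    envelopeCharacter χ₁ χ₂ (p ⊗ₜ op q) = χ₁ p * χ₂ q :=
  rfl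

/-- The common kernel of the characters of the enveloping algebra defined by a family of characters
of the algebra. -/
noncomputable def envelopeRadical {V : Type*} (χ : V → B →ₐ[k] k) : Ideal (Envelope k B) :=
  ⨅ y, ⨅ x, RingHom.ker (envelopeCharacter (χ y) (χ x))

lemma mem_envelopeRadical {V : Type*} {χ : V → B →ₐ[k] k} {r : Envelope k B} :
    r ∈ envelopeRadical χ ↔ ∀ y x, envelopeCharacter (χ y) (χ x) r = 0 := by
  simp [envelopeRadical, Submodule.mem_iInf, RingHom.mem_ker]

end EnvelopeCharacter

namespace QuiverPresentation

open QuiverAlgebra IdempotentModule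

variable {k : Type u} {V : Type v} [Field k] [Quiver.{w} V] [Fintype V]
  {A : Type (max u v w)} [Ring A] [Algebra k A] {φ : QuiverAlgebra k V →ₐ[k] A}

/-- The enveloping algebra of a quotient of `kQ` is spanned by the elements `p ⊗ q` for paths `p` and
`q`. -/
lemma envelope_eq_top (hφ : Function.Surjective φ) {S : Submodule k (Envelope k A)}
    (hS : ∀ {x y x' y' : V} (p : Quiver.Path x y) (q : Quiver.Path x' y'),
      φ (ofPath k p) ⊗ₜ op (φ (ofPath k q)) ∈ S) : S = ⊤ := by
  refine Submodule.eq_top_iff'.mpr fun r => ?_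
  induction r using TensorProduct.induction_on with
  | zero => exact S.zero_mem
  | add r s hr hs => exact S.add_mem hr hs
  | tmul a b =>
    obtain ⟨b, rfl⟩ := op_surjective b
    obtain ⟨z, rfl⟩ := hφ a
    obtain ⟨w, rfl⟩ := hφ b
    induction z using path_induction with
    | zero => rw [map_zero, TensorProduct.zero_tmul]; exact S.zero_mem
    | add z z' h h' => rw [map_add, TensorProduct.add_tmul]; exact S.add_mem h h'
    | smul c z h => rw [map_smul, ← TensorProduct.smul_tmul']; exact S.smul_mem c h
    | path p =>
    induction w using path_induction with
    | zero => rw [map_zero, op_zero, TensorProduct.tmul_zero]; exact S.zero_mem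
    | add z z' h h' =>
      rw [map_add, MulOpposite.op_add, TensorProduct.tmul_add]; exact S.add_mem h h'
    | smul c z h =>
      rw [map_smul, MulOpposite.op_smul, TensorProduct.tmul_smul]; exact S.smul_mem c h
    | path q => exact hS p q

variable (φ) in
/-- The span of the elements `p ⊗ q` for which the sum of the lengths of the paths `p` and `q` is at
least `m`. -/
noncomputable def lengthFiltration (m : ℕ) : Submodule k (Envelope k A) :=
  Submodule.span k {r | ∃ (x y x' y' : V) (p : Quiver.Path x y) (q : Quiver.Path x' y'),
    m ≤ p.length + q.length ∧ r = φ (ofPath k p) ⊗ₜ op (φ (ofPath k q))}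

lemma mul_mem_lengthFiltration {m n : ℕ} {r s : Envelope k A} (hr : r ∈ lengthFiltration φ m)
    (hs : s ∈ lengthFiltration φ n) : r * s ∈ lengthFiltration φ (m + n) := by
  have h : lengthFiltration φ m * lengthFiltration φ n ≤ lengthFiltration φ (m + n) := by
    rw [lengthFiltration, lengthFiltration, Submodule.span_mul_span, Submodule.span_le]
    rintro _ ⟨_, ⟨x, y, x', y', p, q, h, rfl⟩, _, ⟨z, t, z', t', p', q', h', rfl⟩, rfl⟩
    dsimp only
    rw [Algebra.TensorProduct.tmul_mul_tmul, ← op_mul, ← map_mul, ← map_mul]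
    rcases ofPath_mul_ofPath_cases k p p' with h0 | ⟨p₂, hl, hp⟩
    · rw [h0, map_zero, TensorProduct.zero_tmul]
      exact Submodule.zero_mem _
    rcases ofPath_mul_ofPath_cases k q' q with h0 | ⟨q₂, hl', hq⟩
    · rw [h0, map_zero, op_zero, TensorProduct.tmul_zero]
      exact Submodule.zero_mem _
    exact Submodule.subset_span ⟨_, _, _, _, p₂, q₂, by omega, by rw [hp, hq]⟩
  exact h (Submodule.mul_mem_mul hr hs)

lemma lengthFiltration_eq_bot {n : ℕ} (hn : ∀ z ∈ arrowIdeal k V ^ n, φ z = 0) :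
    lengthFiltration φ (n + n) = ⊥ := by
  refine Submodule.span_eq_bot.mpr ?_
  rintro _ ⟨x, y, x', y', p, q, h, rfl⟩
  rcases le_total n p.length with hp | hp
  · rw [hn _ (ofPath_mem_arrowIdeal_pow k p hp), TensorProduct.zero_tmul]
  · rw [hn _ (ofPath_mem_arrowIdeal_pow k q (by omega)), op_zero, TensorProduct.tmul_zero]

section Characters

variable {χ : V → A →ₐ[k] k} (hχ : ∀ x z, χ x (φ z) = vertexCharacter k x z)

include hχ in
/-- Modulo the elements `p ⊗ q` with `p` or `q` of positive length, an element of the enveloping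
algebra is a combination of the elements `y ⊗ x`, whose coefficients are given by the characters. -/
lemma envelopeRadical_le_lengthFiltration (hφ : Function.Surjective φ) {r : Envelope k A}
    (hr : r ∈ envelopeRadical χ) : r ∈ lengthFiltration φ 1 := by
  classical
  let T : Envelope k A →ₗ[k] Envelope k A := LinearMap.id - ∑ y, ∑ x,
    (envelopeCharacter (χ y) (χ x)).toLinearMap.smulRight
      (φ (vertex k y) ⊗ₜ op (φ (vertex k x)))
  have hT : ∀ r, T r = r - ∑ y, ∑ x, envelopeCharacter (χ y) (χ x) r •
      (φ (vertex k y) ⊗ₜ[k] op (φ (vertex k x)) : Envelope k A) := fun r => by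
    simp [T, LinearMap.sum_apply]
  have hTr : ∀ r, T r ∈ lengthFiltration φ 1 := by
    suffices h : (lengthFiltration φ 1).comap T = ⊤ from fun r => by
      have : r ∈ (lengthFiltration φ 1).comap T := h ▸ Submodule.mem_top
      exact this
    refine envelope_eq_top hφ fun {x y x' y'} p q => ?_
    rw [Submodule.mem_comap, hT]
    simp only [envelopeCharacter_tmul, hχ, vertexCharacter_ofPath]
    by_cases h : p.length = 0 ∧ q.length = 0
    · obtain rfl := Quiver.Path.eq_of_length_zero p h.1
      obtain rfl := Quiver.Path.eq_of_length_zero q h.2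
      obtain rfl := Quiver.Path.eq_nil_of_length_zero p h.1
      obtain rfl := Quiver.Path.eq_nil_of_length_zero q h.2
      rw [Finset.sum_eq_single x, Finset.sum_eq_single x']
      · simp [ofPath_nil]
      · intro b _ hb
        simp [hb.symm]
      · simp
      · intro b _ hb
        simp [hb.symm]
      · simp
    · rw [Finset.sum_eq_zero, sub_zero]
      · exact Submodule.subset_span ⟨_, _, _, _, p, q, by omega, rfl⟩
      · intro b _
        refine Finset.sum_eq_zero fun c _ => ?_
        rcases not_and_or.mp h with h | h <;> simp [h]
  have := hTr r
  rw [hT] at this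
  simpa [mem_envelopeRadical.mp hr] using this

include hχ in
lemma envelopeRadical_pow_eq_bot (hφ : Function.Surjective φ) {n : ℕ}
    (hn : ∀ z ∈ arrowIdeal k V ^ n, φ z = 0) : envelopeRadical χ ^ (n + n) = ⊥ := by
  have h : ∀ m, ∀ r ∈ envelopeRadical χ ^ m, r ∈ lengthFiltration φ m := by
    intro m
    induction m with
    | zero =>
      intro r _
      have : lengthFiltration φ 0 = ⊤ := envelope_eq_top hφ fun {x y x' y'} p q =>
        Submodule.subset_span ⟨_, _, _, _, p, q, Nat.zero_le _, rfl⟩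
      exact this ▸ Submodule.mem_top
    | succ m ih =>
      intro r hr
      rw [Submodule.pow_succ] at hr
      induction hr using Submodule.smul_induction_on' with
      | smul r hr s hs =>
        exact mul_mem_lengthFiltration (ih r hr) (envelopeRadical_le_lengthFiltration hχ hφ hs)
      | add r _ s _ hr hs => exact Submodule.add_mem _ hr hs
  refine eq_bot_iff.mpr fun r hr => ?_
  have := h _ r hr
  rwa [lengthFiltration_eq_bot hn] at this

end Characters

end QuiverPresentation

/-! ### The minimal projective presentation of a bound quiver algebra -/

namespace QuiverPresentation

open QuiverAlgebra IdempotentModule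

variable {k : Type u} {V : Type v} [Field k] [Quiver.{w} V] [Fintype V]
  {A : Type (max u v w)} [Ring A] [Algebra k A] {φ : QuiverAlgebra k V →ₐ[k] A}

/-- A linear map on `kQ` that vanishes on the kernel of `φ` descends along `φ`. -/
lemma exists_descent (hφ : Function.Surjective φ) {W : Type*} [AddCommGroup W] [Module k W]
    (f : QuiverAlgebra k V →ₗ[k] W) (hf : ∀ z, φ z = 0 → f z = 0) :
    ∃ g : A →ₗ[k] W, ∀ z, g (φ z) = f z := by
  obtain ⟨s, hs⟩ := φ.toLinearMap.exists_rightInverse_of_surjective (LinearMap.range_eq_top.mpr hφ)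
  refine ⟨f ∘ₗ s, fun z => ?_⟩
  have h : φ (s (φ z) - z) = 0 := by
    rw [map_sub, sub_eq_zero]
    exact LinearMap.congr_fun hs (φ z)
  have := hf _ h
  rwa [map_sub, sub_eq_zero] at this

lemma exists_character (hφ : Function.Surjective φ)
    (hker : ∀ z, φ z = 0 → z ∈ arrowIdeal k V ^ 2) (x : V) :
    ∃ χ : A →ₐ[k] k, ∀ z, χ (φ z) = vertexCharacter k x z := by
  obtain ⟨g, hg⟩ := exists_descent hφ (vertexCharacter k x).toLinearMap fun z hz =>
    eq_zero_of_mem_arrowIdeal_sq k _ (fun z hz w _ => by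
      change vertexCharacter k x (z * w) = 0
      rw [map_mul, vertexCharacter_eq_zero_of_mem k x hz, zero_mul]) (hker z hz)
  refine ⟨AlgHom.ofLinearMap g ?_ fun a b => ?_, hg⟩
  · rw [← map_one φ, hg]
    exact map_one (vertexCharacter k x)
  · obtain ⟨z, rfl⟩ := hφ a
    obtain ⟨w, rfl⟩ := hφ b
    rw [← map_mul, hg, hg, hg]
    exact map_mul (vertexCharacter k x) z w

/-- The character of the enveloping algebra defined by `χ₁` and `χ₂` makes `k` a bimodule. -/
noncomputable def characterAction {B : Type*} [Ring B] [Algebra k B] (χ₁ χ₂ : B →ₐ[k] k) :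
    Envelope k B →ₐ[k] Module.End k k :=
  (Algebra.lmul k k).comp (envelopeCharacter χ₁ χ₂)

lemma characterAction_apply {B : Type*} [Ring B] [Algebra k B] (χ₁ χ₂ : B →ₐ[k] k)
    (r : Envelope k B) (c : k) : characterAction χ₁ χ₂ r c = envelopeCharacter χ₁ χ₂ r * c :=
  rfl

open Classical in
/-- The coefficient of an arrow in a path descends to a derivation of the quotient, because no
arrow occurs in `F²`. -/
lemma exists_arrow_derivation (hφ : Function.Surjective φ)
    (hker : ∀ z, φ z = 0 → z ∈ arrowIdeal k V ^ 2) {χ : V → A →ₐ[k] k}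
    (hχ : ∀ x z, χ x (φ z) = vertexCharacter k x z) (a : Quiver.Arrows V) :
    ∃ δ : A →ₗ[k] k,
      (∀ z w, δ (z * w) = characterAction (χ a.2.1) (χ a.1) (z ⊗ₜ 1) (δ w) +
        characterAction (χ a.2.1) (χ a.1) (1 ⊗ₜ op w) (δ z)) ∧
      ∀ b : Quiver.Arrows V, δ (φ (arrow k b.2.2)) = if b = a then 1 else 0 := by
  obtain ⟨d, hd, hda⟩ := exists_derivation
    (characterAction (vertexCharacter k a.2.1) (vertexCharacter k a.1))
    (fun {x y} b => if (⟨x, y, b⟩ : Quiver.Arrows V) = a then (1 : k) else 0)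
    (fun {x y} b => by
      rw [characterAction_apply, envelopeCharacter_tmul, vertexCharacter_vertex,
        vertexCharacter_vertex]
      by_cases h : (⟨x, y, b⟩ : Quiver.Arrows V) = a
      · subst h
        simp
      · simp [h])
  have hd' : ∀ z w, d (z * w) =
      vertexCharacter k a.2.1 z * d w + vertexCharacter k a.1 w * d z := fun z w => by
    rw [hd, characterAction_apply, characterAction_apply, ← op_one, envelopeCharacter_tmul,
      envelopeCharacter_tmul, map_one, map_one, mul_one, one_mul]
  obtain ⟨δ, hδ⟩ := exists_descent hφ d fun z hz =>
    eq_zero_of_mem_arrowIdeal_sq k _ (fun z hz w hw => by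
      rw [hd', vertexCharacter_eq_zero_of_mem k _ hz, vertexCharacter_eq_zero_of_mem k _ hw,
        zero_mul, zero_mul, add_zero]) (hker z hz)
  refine ⟨δ, fun z w => ?_, fun b => (hδ _).trans (hda b.2.2)⟩
  obtain ⟨z, rfl⟩ := hφ z
  obtain ⟨w, rfl⟩ := hφ w
  rw [← map_mul, hδ, hδ, hδ, hd', characterAction_apply, characterAction_apply, ← op_one,
    envelopeCharacter_tmul, envelopeCharacter_tmul, map_one, map_one, mul_one, one_mul, hχ, hχ]

variable [∀ x y : V, Fintype (x ⟶ y)]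

/-- The kernel of the differential is contained in the radical of `P₁`: the derivation given by the
coefficient of an arrow `a` detects the coefficient of `t(a) ⊗ s(a)`. -/
lemma coord_mem_envelopeRadical (hφ : Function.Surjective φ)
    (hker : ∀ z, φ z = 0 → z ∈ arrowIdeal k V ^ 2) {χ : V → A →ₐ[k] k}
    (hχ : ∀ x z, χ x (φ z) = vertexCharacter k x z)
    {f : IdempotentModule (arrowIdem φ)} (hf : differential φ f = 0) (a : Quiver.Arrows V) :
    coord a f ∈ envelopeRadical χ := by
  classical
  refine mem_envelopeRadical.mpr fun y x => ?_
  by_cases h : a.2.1 = y ∧ a.1 = x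
  · obtain ⟨rfl, rfl⟩ := h
    obtain ⟨δ, hδ, hδa⟩ := exists_arrow_derivation hφ hker hχ a
    have h := totalContraction_differential φ _ δ hδ f
    rw [hf, map_zero, Finset.sum_eq_single a] at h
    · rw [hδa, if_pos rfl, characterAction_apply, mul_one] at h
      exact h.symm
    · intro b _ hb
      rw [hδa, if_neg hb, map_zero]
    · simp
  · rw [← coord_mul f a, map_mul, arrowIdem, envelopeCharacter_tmul, hχ, hχ, vertexCharacter_vertex,
      vertexCharacter_vertex]
    rcases not_and_or.mp h with h | h <;> simp [h]

lemma differential_mem_smul_top {χ : V → A →ₐ[k] k}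
    (hχ : ∀ x z, χ x (φ z) = vertexCharacter k x z) (f : IdempotentModule (arrowIdem φ)) :
    differential φ f ∈
      envelopeRadical χ • (⊤ : Submodule (Envelope k A) (IdempotentModule (vertexIdem φ))) := by
  have h0 : ∀ (x : V) (a : Quiver.Arrows V), χ x (φ (arrow k a.2.2)) = 0 := fun x a => by
    rw [hχ, vertexCharacter_eq_zero_of_mem k x (arrow_mem_arrowIdeal k _)]
  have hl : ∀ a, leftArrow φ a ∈ envelopeRadical χ := fun a => mem_envelopeRadical.mpr fun y x => by
    rw [leftArrow, ← op_one, envelopeCharacter_tmul, h0, zero_mul]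
  have hr : ∀ a, rightArrow φ a ∈ envelopeRadical χ := fun a =>
    mem_envelopeRadical.mpr fun y x => by
      rw [rightArrow, envelopeCharacter_tmul, h0, mul_zero]
  rw [differential_apply]
  exact Submodule.sum_mem _ fun a _ => Submodule.smul_mem _ _ (Submodule.sub_mem _
    (Submodule.smul_mem_smul (hl a) trivial) (Submodule.smul_mem_smul (hr a) trivial))

/-- The standard presentation of the bimodule `A = kQ / I` is minimal if `Fⁿ ⊆ I ⊆ F²`. -/
noncomputable def minimalPresentation (hφ : Function.Surjective φ)
    (hker : ∀ z, φ z = 0 → z ∈ arrowIdeal k V ^ 2) {n : ℕ}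
    (hn : ∀ z ∈ arrowIdeal k V ^ n, φ z = 0) :
    MinimalProjectivePresentation (regularBimodule k A) where
  P₁ := ModuleCat.of _ (IdempotentModule (arrowIdem φ))
  P₀ := ModuleCat.of _ (IdempotentModule (vertexIdem φ))
  d₁ := differential φ
  d₀ := augmentation φ
  projective₁ := projective (isIdempotentElem_arrowIdem φ)
  projective₀ := projective (isIdempotentElem_vertexIdem φ)
  exact := exact_differential_augmentation φ hφ
  surjective := augmentation_surjective φ
  superfluous₁ := by
    choose χ hχ using exists_character hφ hker
    refine isSuperfluous_of_le_smul_top _ (envelopeRadical_pow_eq_bot hχ hφ hn) fun f hf => ?_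
    rw [← sum_smul_gen (isIdempotentElem_arrowIdem φ) f]
    exact Submodule.sum_mem _ fun a _ =>
      Submodule.smul_mem_smul (coord_mem_envelopeRadical hφ hker hχ hf a) trivial
  superfluous₀ := by
    choose χ hχ using exists_character hφ hker
    refine isSuperfluous_of_le_smul_top _ (envelopeRadical_pow_eq_bot hχ hφ hn) fun p hp => ?_
    obtain ⟨f, rfl⟩ := (exact_differential_augmentation φ hφ p).mp hp
    exact differential_mem_smul_top hχ f

/-- The first `τ`-Hochschild cohomology is the double dual of the cokernel of
`Hom(P₀, X) → Hom(P₁, X)`, for any minimal presentation. -/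
lemma nonempty_tauHochschild_equiv (hφ : Function.Surjective φ)
    (hker : ∀ z, φ z = 0 → z ∈ arrowIdeal k V ^ 2) {n : ℕ}
    (hn : ∀ z ∈ arrowIdeal k V ^ n, φ z = 0)
    (P : MinimalProjectivePresentation (regularBimodule k A))
    (X : ModuleCat.{max u v w} (Envelope k A)) :
    Nonempty (TauHochschildCohomology k P X ≃ₗ[k]
      Module.Dual k (Module.Dual k (HomCokernel k (differential φ) X))) := by
  obtain ⟨e₁, e₀, h⟩ := (minimalPresentation hφ hker hn).exists_equiv P
  have : Module.Finite (Envelope k A) (minimalPresentation hφ hker hn).P₀ :=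
    finite (isIdempotentElem_vertexIdem φ)
  have : Module.Finite (Envelope k A) (minimalPresentation hφ hker hn).P₁ :=
    finite (isIdempotentElem_arrowIdem φ)
  have : Module.Finite (Envelope k A) P.P₀ := Module.Finite.equiv e₀
  have : Module.Finite (Envelope k A) P.P₁ := Module.Finite.equiv e₁
  obtain ⟨e⟩ := nonempty_homCokernel_equiv k _ _ e₁ e₀ h X
  have E := LinearEquiv.ofBijective _ (bijective_dualHomCokernelToHom k P X)
  exact ⟨(e.dualMap.symm.trans E).dualMap⟩

end QuiverPresentation

/-! ### Comparison of the two cohomologies -/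

section Restriction

variable (k : Type u) [Field k] {A : Type v} [Ring A] [Algebra k A] {B : Type w} [Ring B]
  [Algebra k B]

/-- The bimodule `A` has the same underlying vector space as the algebra `A`. -/
noncomputable def regularEquiv : A ≃ₗ[k] regularBimodule k A :=
  { toRegular k A with
    map_smul' := fun c z => by
      change toRegular k A (c • z) = c • toRegular k A z
      rw [← algebraMap_smul (Envelope k A) c (toRegular k A z),
        Algebra.TensorProduct.algebraMap_apply, ← op_one, tmul_smul_toRegular, mul_one,
        Algebra.smul_def] }

variable (φ : A →ₐ[k] B) (X : ModuleCat.{w} (Envelope k B))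

/-- Restriction along an algebra morphism does not change the underlying vector space. -/
noncomputable def restrictEquiv : restrictBimodule k φ X ≃ₗ[k] X :=
  { AddEquiv.refl X with
    map_smul' := fun c m =>
      congrArg (fun r : Envelope k B => r • (show X from m))
        ((Algebra.TensorProduct.map φ (AlgHom.op φ)).commutes c) }

lemma restrictEquiv_smul (a b : A) (m : restrictBimodule k φ X) :
    restrictEquiv k φ X ((a ⊗ₜ[k] op b : Envelope k A) • m) =
      (φ a ⊗ₜ[k] op (φ b) : Envelope k B) • restrictEquiv k φ X m :=
  rfl

lemma rank_bimoduleCorner_restrict (a b : A) :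
    Module.rank k (bimoduleCorner k (restrictBimodule k φ X) a b) =
      Module.rank k (bimoduleCorner k X (φ a) (φ b)) := by
  have h : (bimoduleCorner k (restrictBimodule k φ X) a b).map (restrictEquiv k φ X).toLinearMap =
      bimoduleCorner k X (φ a) (φ b) := by
    ext m
    constructor
    · rintro ⟨_, ⟨m, rfl⟩, rfl⟩
      exact ⟨restrictEquiv k φ X m, (restrictEquiv_smul k φ X a b m).symm⟩
    · rintro ⟨m, rfl⟩
      exact ⟨_, ⟨(restrictEquiv k φ X).symm m, rfl⟩, rfl⟩
  rw [← h]
  exact ((restrictEquiv k φ X).submoduleMap _).rank_eq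

lemma rank_bimoduleInvariants_restrict (hφ : Function.Surjective φ) :
    Module.rank k (bimoduleInvariants k (restrictBimodule k φ X)) =
      Module.rank k (bimoduleInvariants k X) := by
  have h : (bimoduleInvariants k (restrictBimodule k φ X)).map (restrictEquiv k φ X).toLinearMap =
      bimoduleInvariants k X := by
    ext m
    constructor
    · rintro ⟨m, hm, rfl⟩
      refine mem_bimoduleInvariants.mpr fun b => ?_
      obtain ⟨a, rfl⟩ := hφ b
      have := congrArg (restrictEquiv k φ X) (mem_bimoduleInvariants.mp hm a)
      rw [← op_one, restrictEquiv_smul, restrictEquiv_smul, map_one] at this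
      exact this
    · intro hm
      refine ⟨(restrictEquiv k φ X).symm m, mem_bimoduleInvariants.mpr fun a => ?_,
        (restrictEquiv k φ X).apply_symm_apply m⟩
      apply (restrictEquiv k φ X).injective
      rw [← op_one, restrictEquiv_smul, restrictEquiv_smul, LinearEquiv.apply_symm_apply, map_one]
      exact mem_bimoduleInvariants.mp hm (φ a)
  rw [← h]
  exact ((restrictEquiv k φ X).submoduleMap _).rank_eq

end Restriction

namespace QuiverPresentation

open QuiverAlgebra IdempotentModule

variable {k : Type u} {V : Type v} [Field k] [Quiver.{w} V] [Fintype V]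
  [∀ x y : V, Fintype (x ⟶ y)] {A : Type (max u v w)} [Ring A] [Algebra k A]

lemma finite_homCokernel (φ : QuiverAlgebra k V →ₐ[k] A) (X : ModuleCat.{max u v w} (Envelope k A))
    [FiniteDimensional k X] : FiniteDimensional k (HomCokernel k (differential φ) X) := by
  have : FiniteDimensional k (IdempotentModule (arrowIdem φ) →ₗ[Envelope k A] X) :=
    Module.Finite.equiv (homEquiv k (isIdempotentElem_arrowIdem φ) X).symm
  infer_instance

lemma finite_hochschildCohomology (X : ModuleCat.{max u v w} (Envelope k (QuiverAlgebra k V)))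
    [FiniteDimensional k X] :
    FiniteDimensional k (HochschildCohomology k (QuiverAlgebra k V) X 1) := by
  obtain ⟨e⟩ := nonempty_homCokernel_equiv_hochschild X
  have := finite_homCokernel (AlgHom.id k (QuiverAlgebra k V)) X
  exact Module.Finite.equiv e

lemma finrank_hochschildCohomology_add
    (X : ModuleCat.{max u v w} (Envelope k (QuiverAlgebra k V))) [FiniteDimensional k X] :
    Module.finrank k (HochschildCohomology k (QuiverAlgebra k V) X 1) +
        ∑ x : V, Module.finrank k (bimoduleCorner k X (vertex k x) (vertex k x)) =
      Module.finrank k (bimoduleInvariants k X) + ∑ a : Quiver.Arrows V,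
        Module.finrank k (bimoduleCorner k X (vertex k a.2.1) (vertex k a.1)) := by
  have := finite_hochschildCohomology X
  have h := rank_hochschildCohomology_add X
  simp only [← Module.finrank_eq_rank] at h
  exact_mod_cast h

/-- The cohomology of `kQ` with coefficients in a restricted bimodule `X` and the cokernel of
`Hom(P₀, X) → Hom(P₁, X)` over the quotient satisfy the same dimension formula. -/
lemma finrank_hochschildCohomology_restrict {φ : QuiverAlgebra k V →ₐ[k] A}
    (hφ : Function.Surjective φ) (X : ModuleCat.{max u v w} (Envelope k A))
    [FiniteDimensional k X] :
    Module.finrank k (HochschildCohomology k (QuiverAlgebra k V) (restrictBimodule k φ X) 1) =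
      Module.finrank k (HomCokernel k (differential φ) X) := by
  have : FiniteDimensional k (restrictBimodule k φ X) :=
    Module.Finite.equiv (restrictEquiv k φ X).symm
  have := finite_homCokernel φ X
  have := finite_hochschildCohomology (restrictBimodule k φ X)
  have h1 := rank_hochschildCohomology_add (restrictBimodule k φ X)
  have h2 := rank_homCokernel_add φ hφ X
  simp only [rank_bimoduleCorner_restrict, rank_bimoduleInvariants_restrict k φ X hφ] at h1
  rw [← h2] at h1
  simp only [← Module.finrank_eq_rank] at h1
  exact Nat.add_right_cancel (by exact_mod_cast h1)

end QuiverPresentation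

open QuiverPresentation in
theorem mainTheorem11 (k : Type u) [Field k] (V : Type v) [Quiver.{w} V] [Fintype V]
    [∀ x y : V, Fintype (x ⟶ y)] :
    (∀ X : ModuleCat.{max u v w} (Envelope k (QuiverAlgebra k V)),
      Module.rank k (HochschildCohomology k (QuiverAlgebra k V) X 1) +
          ∑ x : V, Module.rank k
            (bimoduleCorner k X (QuiverAlgebra.vertex k x) (QuiverAlgebra.vertex k x)) =
        Module.rank k (bimoduleInvariants k X) +
          ∑ x : V, ∑ y : V, ∑ _a : x ⟶ y, Module.rank k
            (bimoduleCorner k X (QuiverAlgebra.vertex k y) (QuiverAlgebra.vertex k x))) ∧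
    (∀ X : ModuleCat.{max u v w} (Envelope k (QuiverAlgebra k V)), FiniteDimensional k X →
      FiniteDimensional k (HochschildCohomology k (QuiverAlgebra k V) X 1) ∧
      (Module.finrank k (HochschildCohomology k (QuiverAlgebra k V) X 1) : ℤ) =
        (Module.finrank k (bimoduleInvariants k X) : ℤ) -
          ∑ x : V, (Module.finrank k
            (bimoduleCorner k X (QuiverAlgebra.vertex k x) (QuiverAlgebra.vertex k x)) : ℤ) +
          ∑ x : V, ∑ y : V, ∑ _a : x ⟶ y, (Module.finrank k
            (bimoduleCorner k X (QuiverAlgebra.vertex k y) (QuiverAlgebra.vertex k x)) : ℤ)) ∧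
    ∀ (I : Ideal (QuiverAlgebra k V)) [I.IsTwoSided], QuiverAlgebra.IsAdmissible I →
      FiniteDimensional k (HochschildCohomology k (QuiverAlgebra k V)
        (restrictBimodule k (Ideal.Quotient.mkₐ k I)
          (regularBimodule k (QuiverAlgebra k V ⧸ I))) 1) ∧
      Nonempty (MinimalProjectivePresentation (regularBimodule k (QuiverAlgebra k V ⧸ I))) ∧
      ∀ P : MinimalProjectivePresentation (regularBimodule k (QuiverAlgebra k V ⧸ I)),
        FiniteDimensional k
          (TauHochschildCohomology k P (regularBimodule k (QuiverAlgebra k V ⧸ I))) ∧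
        Module.finrank k (HochschildCohomology k (QuiverAlgebra k V)
            (restrictBimodule k (Ideal.Quotient.mkₐ k I)
              (regularBimodule k (QuiverAlgebra k V ⧸ I))) 1) =
          Module.finrank k
            (TauHochschildCohomology k P (regularBimodule k (QuiverAlgebra k V ⧸ I))) := by
  refine ⟨fun X => ?_, fun X hX => ?_, fun I hI => ?_⟩
  · simpa only [Fintype.sum_sigma] using rank_hochschildCohomology_add X
  · have h := finrank_hochschildCohomology_add X
    simp only [Fintype.sum_sigma] at h
    refine ⟨finite_hochschildCohomology X, ?_⟩
    have h' := congrArg (Nat.cast : ℕ → ℤ) h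
    push_cast at h'
    linarith
  · rintro ⟨n, -, hn, hI2⟩
    let φ : QuiverAlgebra k V →ₐ[k] QuiverAlgebra k V ⧸ I := Ideal.Quotient.mkₐ k I
    have hφ : Function.Surjective φ := Ideal.Quotient.mkₐ_surjective k I
    have hker : ∀ z, φ z = 0 → z ∈ QuiverAlgebra.arrowIdeal k V ^ 2 := fun z hz =>
      hI2 (Ideal.Quotient.eq_zero_iff_mem.mp hz)
    have hn' : ∀ z ∈ QuiverAlgebra.arrowIdeal k V ^ n, φ z = 0 := fun z hz =>
      Ideal.Quotient.eq_zero_iff_mem.mpr (hn hz)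
    have hfin : FiniteDimensional k (QuiverAlgebra k V ⧸ I) :=
      QuiverAlgebra.finite_of_surjective k φ hφ hn'
    have hX : FiniteDimensional k (regularBimodule k (QuiverAlgebra k V ⧸ I)) :=
      Module.Finite.equiv (regularEquiv k)
    have hres : FiniteDimensional k
        (restrictBimodule k φ (regularBimodule k (QuiverAlgebra k V ⧸ I))) :=
      Module.Finite.equiv (restrictEquiv k φ _).symm
    refine ⟨finite_hochschildCohomology _, ⟨minimalPresentation hφ hker hn'⟩, fun P => ?_⟩
    obtain ⟨e⟩ := nonempty_tauHochschild_equiv hφ hker hn' P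
      (regularBimodule k (QuiverAlgebra k V ⧸ I))
    have hcok := finite_homCokernel φ (regularBimodule k (QuiverAlgebra k V ⧸ I))
    refine ⟨Module.Finite.equiv e.symm, ?_⟩
    rw [e.finrank_eq, Subspace.dual_finrank_eq, Subspace.dual_finrank_eq]
    exact finrank_hochschildCohomology_restrict hφ _
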